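/- Consider a game of $K$ players over rounds $t=1,\dots,n$, in which player $l$ has $N_l$ actions. Let $g_t^{(k)}(\mathbf i)\in[0,1]$ be the (possibly random) reward of player $k$ in round $t$ as a function of the joint action profile $\mathbf i$, let $\mathbf I_t$ be the profile played in round $t$, and let $\mathbf I_{t,k}^-$ be the actions of the players other than $k$. The opponents and the environment are arbitrary; what they do in round $t$ may be randomized and may depend on everything that happened before round $t$. Given all this information (the past, and what the opponents and the environment do in round $t$), player $k$ draws $I_t^{(k)}$ from a mixed strategy $P_t=(p_{1,t},\dots,p_{N_k,t})$, and observes only the reward $g_t^{(k)}(\mathbf I_t)$. The internal regret of player $k$ is $$R^{(k)}_{\mathrm{Int}}(n)=\max_{i,j}\sum_{t=1}^n p_{i,t}\bigl(g_t^{(k)}(j,\mathbf I_{t,k}^-)-g_t^{(k)}(i,\mathbf I_{t,k}^-)\bigr).$$ The strategy NR-BEWAS with known horizon $n$ uses the constant parameters $$\eta=\Bigl(\frac{\ln N_k}{2N_kn}\Bigr)^{2/3},\qquad \gamma=\Bigl(\frac{N_k^2\ln N_k}{4n}\Bigr)^{1/3}.$$ $P_1$ is uniform. After round $s$ put $\tilde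 g_s(i)=g_s^{(k)}(\mathbf I_s)/p_{i,s}$ if $i=I_s^{(k)}$ and $\tilde g_s(i)=0$ otherwise, and for $t\ge2$ let $$\tilde R_{(i\to j),t-1}=\sum_{s=1}^{t-1}p_{i,s}\bigl(\tilde g_s(j)-\tilde g_s(i)\bigr),\qquad \delta_{(i\to j),t}=\frac{\exp(\eta\tilde R_{(i\to j),t-1})}{\sum_{m\ne l}\exp(\eta\tilde R_{(m\to l),t-1})}\quad(i\neq j).$$ Let $Q_t$ be the probability vector that solves $Q_t=\sum_{i\neq j}\delta_{(i\to j),t}\,Q_t^{(i\to j)}$, where $Q^{(i\to j)}$ arises from $Q$ by moving the mass of action $i$ to action $j$ (if $N_k=1$, then $Q_t=(1)$); then $p_{i,t}=(1-\gamma)q_{i,t}+\gamma/N_k$. By a run with horizon $n$ we mean that $P_1,\dots,P_n$, computed in this way, are the mixed strategies from which player $k$ draws; in particular they are probability vectors, which is automatic for $\gamma\le1$, that is, for $n\ge \frac14N_k^2\ln N_k$. Then $R^{(k)}_{\mathrm{Int}}\in O\bigl((nN_k^2\ln N_k)^{2/3}\bigr)$ and the internal regret vanishes, in the following sense. 1.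 There is an absolute constant $C$ such that in every run with horizon $n$, $\;\mathbb E\,R^{(k)}_{\mathrm{Int}}(n)\le C\,(nN_k^2\ln N_k)^{2/3}$. 2. For every $\delta>0$ there is a constant $C_\delta$, depending on $\delta$ only, such that in every run with horizon $n$, $\;\Pr\bigl(R^{(k)}_{\mathrm{Int}}(n)>C_\delta\,(nN_k^2\ln N_k)^{2/3}\bigr)\le\delta$. 3. If for the same $K$, $N_1,\dots,N_K$ and $k$ and for every sufficiently large $n$ a run with horizon $n$ is given, all on one probability space with any dependence between them (and with rewards and opponents that may differ from horizon to horizon), then $\frac1nR^{(k)}_{\mathrm{Int}}(n)\to0$ almost surely as $n\to\infty$. -/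

import Mathlib

open MeasureTheory Filter Topology

noncomputable section

namespace NRBEWAS

/-! ### The algorithm, for a player with actions `Fin N`

Rounds are numbered `0, 1, …, n - 1`. -/

/-- `P^{(i → j)}` (for `i ≠ j`): the mass of action `i` is moved to action `j`. -/
def shift {N : ℕ} (P : Fin N → ℝ) (i j : Fin N) : Fin N → ℝ :=
  Function.update (Function.update P i 0) j (P j + P i)

/-- `P` is a probability vector and `P = ∑_{i ≠ j} δ_{(i → j)} P^{(i → j)}`. -/
def IsFixedPoint {N : ℕ} (δ : Fin N → Fin N → ℝ) (P : Fin N → ℝ) : Prop :=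
  P ∈ stdSimplex ℝ (Fin N) ∧
    ∀ l, P l = ∑ e ∈ (Finset.univ : Finset (Fin N)).offDiag, δ e.1 e.2 * shift P e.1 e.2 l

open Classical in
/-- The solution of the fixed point equation. For the weights `δ` that the algorithm uses it exists
and is unique as soon as `2 ≤ N` (see below); for `N = 1` there are no pairs `i ≠ j`, the equation
is void, and the value is the only probability vector. -/
def fixedPoint {N : ℕ} (δ : Fin N → Fin N → ℝ) : Fin N → ℝ :=
  if h : ∃ P, IsFixedPoint δ P then h.choose else fun _ => 1 / (N : ℝ)

/-- Estimated rewards of all actions when `a` is drawn from `P` and the reward `x` is observed. -/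
def estReward {N : ℕ} (P : Fin N → ℝ) (a : Fin N) (x : ℝ) (i : Fin N) : ℝ :=
  if i = a then x / P i else 0

/-- Estimated one-round regrets `r̃_{(i → j)} = p_i (g̃(j) - g̃(i))`. -/
def estRegret {N : ℕ} (P : Fin N → ℝ) (a : Fin N) (x : ℝ) (i j : Fin N) : ℝ :=
  P i * (estReward P a x j - estReward P a x i)

/-- The exponential weights `δ_{(i → j)}` of the virtual actions `(i → j)`, `i ≠ j`. -/
def pairWeight {N : ℕ} (η : ℝ) (R : Fin N → Fin N → ℝ) (i j : Fin N) : ℝ :=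
  Real.exp (η * R i j) /
    ∑ e ∈ (Finset.univ : Finset (Fin N)).offDiag, Real.exp (η * R e.1 e.2)

/-- The mixed strategy of a round, computed from the accumulated estimated regrets `R`. -/
def nextStrategy {N : ℕ} (η γ : ℝ) (R : Fin N → Fin N → ℝ) (i : Fin N) : ℝ :=
  (1 - γ) * fixedPoint (pairWeight η R) i + γ / N

/-- State of the algorithm at the beginning of round `t`: the mixed strategy that is used in
round `t`, and the accumulated estimated regrets of the rounds before `t`. Here `a s` and `x s` are
the action played and the reward observed in round `s`; only rounds `s < t` matter. -/
def state {N : ℕ} (η γ : ℝ) (a : ℕ → Fin N) (x : ℕ → ℝ) :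
    ℕ → (Fin N → ℝ) × (Fin N → Fin N → ℝ)
  | 0 => (fun _ => 1 / (N : ℝ), fun _ _ => 0)
  | t + 1 =>
    let P := (state η γ a x t).1
    let R : Fin N → Fin N → ℝ :=
      fun i j => (state η γ a x t).2 i j + estRegret P (a t) (x t) i j
    (nextStrategy η γ R, R)

/-- The learning rate for `N` actions and horizon `n`. -/
def etaParam (N n : ℕ) : ℝ := (Real.log N / (2 * N * n)) ^ (2 / 3 : ℝ)

/-- The exploration rate for `N` actions and horizon `n`. -/
def gammaParam (N n : ℕ) : ℝ := ((N : ℝ) ^ 2 * Real.log N / (4 * n)) ^ (1 / 3 : ℝ)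

/-! ### The fixed point equation is well posed -/

lemma sum_shift {N : ℕ} (δ : Fin N → Fin N → ℝ) (P : Fin N → ℝ)
    (hδ : ∑ e ∈ (Finset.univ : Finset (Fin N)).offDiag, δ e.1 e.2 = 1) (l : Fin N) :
    ∑ e ∈ (Finset.univ : Finset (Fin N)).offDiag, δ e.1 e.2 * shift P e.1 e.2 l =
      P l + ∑ i, ((if l ≠ i then δ i l else 0) * P i - (if l ≠ i then δ l i else 0) * P l) := by
  have h1 : ∀ e ∈ (Finset.univ : Finset (Fin N)).offDiag, δ e.1 e.2 * shift P e.1 e.2 l =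
      δ e.1 e.2 * P l + (if e.2 = l then δ e.1 e.2 * P e.1 else 0)
        - (if e.1 = l then δ e.1 e.2 * P e.1 else 0) := by
    rintro ⟨i, j⟩ he
    have hij : i ≠ j := by simpa using he
    simp only [shift, Function.update_apply]
    split_ifs with h h' h' <;> grind
  rw [Finset.sum_congr rfl h1, Finset.sum_sub_distrib, Finset.sum_add_distrib, ← Finset.sum_mul, hδ,
    one_mul, add_sub_assoc, Finset.sum_sub_distrib]
  have h2 : ∀ f : Fin N → Fin N → ℝ,
      ∑ e ∈ (Finset.univ : Finset (Fin N)).offDiag, f e.1 e.2 =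
        ∑ i, ∑ j, if i ≠ j then f i j else 0 := by
    intro f
    rw [← Finset.sum_product', ← Finset.sum_filter]
    exact Finset.sum_congr (by ext; simp) fun _ _ => rfl
  rw [h2 fun i j => if j = l then δ i j * P i else 0, h2 fun i j => if i = l then δ i j * P i else 0]
  congr 2
  · refine Finset.sum_congr rfl fun i _ => ?_
    rw [Finset.sum_eq_single l] <;> grind
  · rw [Finset.sum_eq_single l]
    · refine Finset.sum_congr rfl fun i _ => ?_
      grind
    · intro b _ hb
      exact Finset.sum_eq_zero fun j _ => by grind
    · simp

/-- The absolute values of a solution of the balance equations form a solution. -/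
lemma abs_balance {N : ℕ} (c : Fin N → Fin N → ℝ) (hc : ∀ i j, 0 ≤ c i j) (v : Fin N → ℝ)
    (hv : ∀ l, ∑ i, (c i l * v i - c l i * v l) = 0) (l : Fin N) :
    ∑ i, (c i l * |v i| - c l i * |v l|) = 0 := by
  have hnn : ∀ l ∈ (Finset.univ : Finset (Fin N)), 0 ≤ ∑ i, (c i l * |v i| - c l i * |v l|) := by
    intro l _
    have := hv l
    rw [Finset.sum_sub_distrib, ← Finset.sum_mul] at this ⊢
    have h1 : |(∑ i, c l i) * v l| ≤ ∑ i, c i l * |v i| := by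
      rw [← sub_eq_zero.1 this]
      refine (Finset.abs_sum_le_sum_abs _ _).trans (Finset.sum_le_sum fun i _ => ?_)
      rw [abs_mul, abs_of_nonneg (hc _ _)]
    rw [abs_mul, abs_of_nonneg (Finset.sum_nonneg fun i _ => hc l i)] at h1
    linarith
  have htot : ∑ l, ∑ i, (c i l * |v i| - c l i * |v l|) = 0 := by
    simp only [Finset.sum_sub_distrib]
    rw [Finset.sum_comm, sub_self]
  exact (Finset.sum_eq_zero_iff_of_nonneg hnn).1 htot l (Finset.mem_univ l)

lemma isFixedPoint_iff {N : ℕ} (δ : Fin N → Fin N → ℝ)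
    (hδ : ∑ e ∈ (Finset.univ : Finset (Fin N)).offDiag, δ e.1 e.2 = 1) (P : Fin N → ℝ) :
    IsFixedPoint δ P ↔ P ∈ stdSimplex ℝ (Fin N) ∧ ∀ l, ∑ i,
      ((if l ≠ i then δ i l else 0) * P i - (if i ≠ l then δ l i else 0) * P l) = 0 := by
  refine and_congr_right fun _ => forall_congr' fun l => ?_
  rw [sum_shift δ P hδ l]
  simp only [ne_comm (a := l)]
  constructor <;> intro h <;> linarith

lemma exists_isFixedPoint {N : ℕ} (δ : Fin N → Fin N → ℝ) (h0 : ∀ i j, 0 ≤ δ i j)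
    (hδ : ∑ e ∈ (Finset.univ : Finset (Fin N)).offDiag, δ e.1 e.2 = 1) :
    ∃ P, IsFixedPoint δ P := by
  have hN : Nonempty (Fin N) := by
    by_contra h
    rw [not_nonempty_iff] at h
    simp at hδ
  set c : Fin N → Fin N → ℝ := fun i j => if j ≠ i then δ i j else 0 with hc
  have hc0 : ∀ i j, 0 ≤ c i j := fun i j => by
    simp only [hc]; split_ifs <;> simp [h0]
  let B : Matrix (Fin N) (Fin N) ℝ :=
    Matrix.of fun l i => c i l - if i = l then ∑ m, c l m else 0
  have hB : ∀ v l, (B.mulVec v) l = ∑ i, (c i l * v i - c l i * v l) := by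
    intro v l
    simp [B, Matrix.mulVec, dotProduct, sub_mul, Finset.sum_sub_distrib, Finset.sum_mul]
  obtain ⟨v, hv, hv0⟩ : ∃ v, v ≠ 0 ∧ B.mulVec v = 0 := by
    rw [Matrix.exists_mulVec_eq_zero_iff, ← Matrix.exists_vecMul_eq_zero_iff]
    refine ⟨fun _ => 1, fun h => one_ne_zero (congrFun h hN.some), ?_⟩
    ext i
    simp [B, Matrix.vecMul, dotProduct, Finset.sum_sub_distrib]
  have hbal := abs_balance c hc0 v fun l => by rw [← hB, hv0]; rfl
  have hpos : 0 < ∑ i, |v i| := by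
    obtain ⟨i, hi⟩ := Function.ne_iff.1 hv
    exact Finset.sum_pos' (fun i _ => abs_nonneg _) ⟨i, Finset.mem_univ i, abs_pos.2 hi⟩
  refine ⟨fun i => |v i| / ∑ j, |v j|, (isFixedPoint_iff δ hδ _).2 ⟨⟨fun i => by positivity, ?_⟩, ?_⟩⟩
  · rw [← Finset.sum_div, div_self hpos.ne']
  · intro l
    have := hbal l
    simp only [hc] at this
    simp only [← mul_div_assoc, ← sub_div]
    rw [← Finset.sum_div, this, zero_div]

lemma isFixedPoint_unique {N : ℕ} (δ : Fin N → Fin N → ℝ) (h0 : ∀ i j, 0 < δ i j)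
    (hδ : ∑ e ∈ (Finset.univ : Finset (Fin N)).offDiag, δ e.1 e.2 = 1) {P Q : Fin N → ℝ}
    (hP : IsFixedPoint δ P) (hQ : IsFixedPoint δ Q) : P = Q := by
  rw [isFixedPoint_iff δ hδ] at hP hQ
  set c : Fin N → Fin N → ℝ := fun i j => if j ≠ i then δ i j else 0 with hc
  have hc0 : ∀ i j, 0 ≤ c i j := fun i j => by
    simp only [hc]; split_ifs <;> simp [(h0 i j).le]
  set v : Fin N → ℝ := fun i => P i - Q i with hv
  have hbal : ∀ l, ∑ i, (c i l * v i - c l i * v l) = 0 := by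
    intro l
    have := congrArg₂ (· - ·) (hP.2 l) (hQ.2 l)
    simp only [← Finset.sum_sub_distrib, sub_zero] at this
    rw [← this]
    exact Finset.sum_congr rfl fun i _ => by simp only [hv, hc]; ring
  have habs := abs_balance c hc0 v hbal
  have hsum : ∑ i, v i = 0 := by
    simp only [hv, Finset.sum_sub_distrib, hP.1.2, hQ.1.2, sub_self]
  have hle : ∀ i, v i ≤ 0 := by
    by_contra! h
    obtain ⟨i, hi⟩ := h
    obtain ⟨l, hl⟩ : ∃ l, v l < 0 := by
      by_contra! h
      exact hi.ne' ((Finset.sum_eq_zero_iff_of_nonneg fun i _ => h i).1 hsum i (Finset.mem_univ i))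
    have hli : l ≠ i := by rintro rfl; linarith
    have h1 : ∑ m, c m l * (v m + |v m|) = 0 := by
      have := congrArg₂ (· + ·) (hbal l) (habs l)
      simp only [← Finset.sum_add_distrib, add_zero] at this
      rw [← this]
      refine Finset.sum_congr rfl fun m _ => ?_
      rw [abs_of_neg hl]; ring
    have h2 : ∀ m ∈ (Finset.univ : Finset (Fin N)), 0 ≤ c m l * (v m + |v m|) := fun m _ =>
      mul_nonneg (hc0 _ _) (by linarith [neg_abs_le (v m)])
    have h3 := (Finset.sum_eq_zero_iff_of_nonneg h2).1 h1 i (Finset.mem_univ i)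
    have h4 : 0 < c i l := by simp only [hc, if_pos hli]; exact h0 i l
    rw [abs_of_pos hi] at h3
    nlinarith
  ext i
  have := (Finset.sum_eq_zero_iff_of_nonpos fun i _ => hle i).1 hsum i (Finset.mem_univ i)
  simpa [hv, sub_eq_zero] using this

lemma pairWeight_pos {N : ℕ} (hN : 2 ≤ N) (η : ℝ) (R : Fin N → Fin N → ℝ) (i j : Fin N) :
    0 < pairWeight η R i j := by
  have : (Finset.univ : Finset (Fin N)).offDiag.Nonempty :=
    ⟨(⟨0, by omega⟩, ⟨1, by omega⟩), by simp⟩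
  exact div_pos (Real.exp_pos _) (Finset.sum_pos (fun _ _ => Real.exp_pos _) this)

lemma sum_pairWeight {N : ℕ} (hN : 2 ≤ N) (η : ℝ) (R : Fin N → Fin N → ℝ) :
    ∑ e ∈ (Finset.univ : Finset (Fin N)).offDiag, pairWeight η R e.1 e.2 = 1 := by
  have : (Finset.univ : Finset (Fin N)).offDiag.Nonempty :=
    ⟨(⟨0, by omega⟩, ⟨1, by omega⟩), by simp⟩
  simp only [pairWeight]
  rw [← Finset.sum_div, div_self (Finset.sum_pos (fun _ _ => Real.exp_pos _) this).ne']

/-- For at least two actions, `fixedPoint` is the solution of the equation that the algorithm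
solves, and there is no other solution. -/
lemma isFixedPoint_pairWeight_iff {N : ℕ} (hN : 2 ≤ N) (η : ℝ) (R : Fin N → Fin N → ℝ)
    (P : Fin N → ℝ) :
    IsFixedPoint (pairWeight η R) P ↔ P = fixedPoint (pairWeight η R) := by
  have hex := exists_isFixedPoint _ (fun i j => (pairWeight_pos hN η R i j).le)
    (sum_pairWeight hN η R)
  have hfix : IsFixedPoint (pairWeight η R) (fixedPoint (pairWeight η R)) := by
    rw [fixedPoint, dif_pos hex]; exact hex.choose_spec
  refine ⟨fun h => ?_, fun h => h ▸ hfix⟩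
  exact isFixedPoint_unique _ (pairWeight_pos hN η R) (sum_pairWeight hN η R) h hfix

/-! ### The game

There are `K` players; player `l` has the actions `Fin (N l)`. `g t ω` is the (possibly random)
reward function of player `k` in round `t`, a function of the joint action profile, and `I t ω` is
the joint action profile played in round `t`. -/

/-- The reward `g_t(i, I_t⁻)` of player `k` in round `t` if `k` plays `i` and all the other players
play as they do. -/
def rewardOf {K : ℕ} {N : Fin K → ℕ} {Ω : Type*} (k : Fin K)
    (g : ℕ → Ω → (∀ l, Fin (N l)) → ℝ) (I : ℕ → Ω → ∀ l, Fin (N l))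
    (t : ℕ) (ω : Ω) (i : Fin (N k)) : ℝ :=
  g t ω (Function.update (I t ω) k i)

/-- The mixed strategy of player `k` in round `t` that the algorithm with parameters `η`, `γ`
computes from the actions and rewards of player `k` in the earlier rounds. -/
def strategy {K : ℕ} {N : Fin K → ℕ} {Ω : Type*} (η γ : ℝ) (k : Fin K)
    (g : ℕ → Ω → (∀ l, Fin (N l)) → ℝ) (I : ℕ → Ω → ∀ l, Fin (N l)) (t : ℕ) (ω : Ω) :
    Fin (N k) → ℝ :=
  (state η γ (fun s => I s ω k) (fun s => g s ω (I s ω)) t).1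

/-- Player `k` plays NR-BEWAS with the parameters for the known horizon `n` during rounds
`0, …, n - 1`, against arbitrary (also non-oblivious and randomizing) opponents and rewards.

`ℱ t` is the information that exists when player `k` draws the action of round `t`: everything that
happened before round `t`, and what the opponents and the environment do in round `t`. The
player draws the action from the mixed strategy independently of anything else. -/
structure IsRun {K : ℕ} {N : Fin K → ℕ} {Ω : Type*} {m : MeasurableSpace Ω} (μ : Measure Ω)
    (ℱ : Filtration ℕ m) (n : ℕ) (k : Fin K)
    (g : ℕ → Ω → (∀ l, Fin (N l)) → ℝ) (I : ℕ → Ω → ∀ l, Fin (N l)) : Prop where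
  reward_mem : ∀ t < n, ∀ ω a, g t ω a ∈ Set.Icc (0 : ℝ) 1
  reward_meas : ∀ t < n, ∀ i, Measurable[ℱ t] fun ω => rewardOf k g I t ω i
  action_meas : ∀ t < n, ∀ i, MeasurableSet[ℱ (t + 1)] {ω | I t ω k = i}
  action_law : ∀ t < n, ∀ i,
    μ[Set.indicator {ω | I t ω k = i} (fun _ => (1 : ℝ)) | ℱ t] =ᵐ[μ]
      fun ω => strategy (etaParam (N k) n) (gammaParam (N k) n) k g I t ω i

/-- The internal regret of player `k` over the `n` rounds of a run with horizon `n`: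
`max_{i,j} ∑_t p_{i,t} (g_t(j, I_t⁻) - g_t(i, I_t⁻))`. -/
def internalRegret {K : ℕ} {N : Fin K → ℕ} {Ω : Type*} (n : ℕ) (k : Fin K)
    (g : ℕ → Ω → (∀ l, Fin (N l)) → ℝ) (I : ℕ → Ω → ∀ l, Fin (N l)) (ω : Ω) : ℝ :=
  ⨆ e : Fin (N k) × Fin (N k), ∑ t ∈ Finset.range n,
    strategy (etaParam (N k) n) (gammaParam (N k) n) k g I t ω e.1 *
      (rewardOf k g I t ω e.2 - rewardOf k g I t ω e.1)

/-- The rate `(n N² ln N)^{2/3}`. -/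
def rate (N n : ℕ) : ℝ := (n * (N : ℝ) ^ 2 * Real.log N) ^ (2 / 3 : ℝ)

end NRBEWAS

end

noncomputable section

namespace NRBEWAS

-- The proof controls an exponential moment of the true regret directly, without first bounding the
-- estimated regret and then the estimation error. For a pair `(i, j)`, `potential` multiplies the
-- total exponential weight of all estimated regrets by `exp (η * (true regret - estimated regret))`
-- of that pair. It dominates `exp (η * true regret)`, since `(i, j)` is itself one of the summands
-- (`exp_pairRegret_le_potential`).
--
-- In one round the potential is multiplied by a `δ`-average of exponentials, `growth`. To first
-- order, the conditional mean sees only the true one-round regrets: the correction term for `(i,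
-- j)` is centred. The fixed point equation makes their `δ`-average vanish
-- (`IsFixedPoint.sum_regret_eq_zero`), up to the exploration part. With `c = γ / N` and `u = η /
-- c`, exploration costs at most `u * c ^ 2`. The second-order term costs `16 * u ^ 2 * c`, because
-- importance weighting keeps second moments of order `1 / c`. As `c ≤ u`, the mean growth is at
-- most `exp (17 * u ^ 3)` (`sum_mul_growth_le`). The parameters give `n * u ^ 3 ≤ log N / 2`, so
-- after `n` rounds the potential has mean at most `N ^ 11`. Summing over pairs bounds the
-- exponential moment of the internal regret by `N ^ 13` (`integral_exp_internalRegret_le`).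
--
-- Convexity of `exp` turns this into a mean of at most `13 * log N / η`, hence the rate; Markov's
-- inequality gives the bound in probability. Markov's inequality for the exponential moment gives
-- tails summable in `n`, so Borel–Cantelli yields almost sure convergence under any coupling. If `γ
-- > 1`, the trivial bound `n` is already below the rate.

lemma exp_le_one_add_two_sq {x : ℝ} (hx : x ≤ 2) : Real.exp x ≤ 1 + x + 2 * x ^ 2 := by
  rcases le_or_gt (-2) x with h | h
  -- The quadratic bound for `exp` is available on `[-1, 1]`; applying it at `x / 2` and squaring
  -- extends the range to `[-2, 2]`.
  · have h1 := abs_le.1 (Real.abs_exp_sub_one_sub_id_le (x := x / 2) (abs_le.2 ⟨by linarith, by linarith⟩))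
    have h2 : Real.exp x = Real.exp (x / 2) ^ 2 := by rw [← Real.exp_nat_mul]; congr 1; push_cast; ring
    have h3 : Real.exp (x / 2) ≤ 1 + x / 2 + (x / 2) ^ 2 := by linarith
    rw [h2]
    have h4 : Real.exp (x / 2) ^ 2 ≤ (1 + x / 2 + (x / 2) ^ 2) ^ 2 :=
      pow_le_pow_left₀ (Real.exp_pos _).le h3 2
    nlinarith [mul_nonneg (sq_nonneg x) (sub_nonneg.2 hx), sq_nonneg x,
      mul_nonneg (sq_nonneg x) (mul_nonneg (sub_nonneg.2 hx) (by linarith : 0 ≤ x + 2))]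
  · have h1 : Real.exp x ≤ 1 := Real.exp_le_one_iff.2 (by linarith)
    nlinarith

/-! ### One-round estimates of the regret -/

variable {N : ℕ}

/-- Moving the mass of `i` to `j` changes the mean payoff of `q` by `q i * (r j - r i)`. The
`δ`-average of the modified strategies is `q` itself, so these changes cancel on average, whatever
the rewards are. -/
lemma IsFixedPoint.sum_regret_eq_zero {δ : Fin N → Fin N → ℝ} {q : Fin N → ℝ}
    (hδ : ∑ e ∈ (Finset.univ : Finset (Fin N)).offDiag, δ e.1 e.2 = 1)
    (hq : IsFixedPoint δ q) (r : Fin N → ℝ) :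
    ∑ e ∈ (Finset.univ : Finset (Fin N)).offDiag, δ e.1 e.2 * (q e.1 * (r e.2 - r e.1)) = 0 := by
  have h1 : ∀ e ∈ (Finset.univ : Finset (Fin N)).offDiag,
      δ e.1 e.2 * (q e.1 * (r e.2 - r e.1)) =
        δ e.1 e.2 * ∑ l, shift q e.1 e.2 l * r l - δ e.1 e.2 * ∑ l, q l * r l := by
    rintro ⟨i, j⟩ he
    have hij : i ≠ j := by simpa using he
    rw [← mul_sub, ← Finset.sum_sub_distrib]
    congr 1
    have h2 : ∀ l, shift q i j l * r l - q l * r l =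
        (if l = j then q i * r j else 0) - (if l = i then q i * r i else 0) := by
      intro l
      simp only [shift, Function.update_apply]
      split_ifs <;> grind
    simp only [h2, Finset.sum_sub_distrib, Finset.sum_ite_eq', Finset.mem_univ, if_true]
    ring
  rw [Finset.sum_congr rfl h1, Finset.sum_sub_distrib, ← Finset.sum_mul, hδ, one_mul, sub_eq_zero]
  simp only [Finset.mul_sum]
  rw [Finset.sum_comm]
  refine Finset.sum_congr rfl fun l _ => ?_
  conv_rhs => rw [hq.2 l]
  rw [Finset.sum_mul]
  exact Finset.sum_congr rfl fun e _ => by ring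

lemma estRegret_eq (p r : Fin N → ℝ) (a i j : Fin N) :
    estRegret p a (r a) i j =
      (if j = a then p i * (r j / p j) else 0) - (if i = a then p i * (r i / p i) else 0) := by
  simp only [estRegret, estReward]
  split_ifs <;> subst_vars <;> ring

lemma sum_mul_estRegret {p : Fin N → ℝ} (hp : ∀ i, 0 < p i) (r : Fin N → ℝ) (i j : Fin N) :
    ∑ a, p a * estRegret p a (r a) i j = p i * (r j - r i) := by
  simp only [estRegret_eq, mul_sub, Finset.sum_sub_distrib, mul_ite, mul_zero, Finset.sum_ite_eq,
    Finset.mem_univ, if_true]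
  have := (hp i).ne'
  have := (hp j).ne'
  field_simp

lemma estRegret_sq_le {p : Fin N → ℝ} (hp : ∀ i, 0 < p i) {r : Fin N → ℝ}
    (i j a : Fin N) :
    estRegret p a (r a) i j ^ 2 ≤
      (if j = a then (p i * (r j / p j)) ^ 2 else 0) + (if i = a then r i ^ 2 else 0) := by
  have hi := (hp i).ne'
  have h : p i * (r i / p i) = r i := by field_simp
  rw [estRegret_eq, h]
  by_cases h1 : j = a <;> by_cases h2 : i = a
  · subst h1; subst h2
    simp [h, sq_nonneg]
  all_goals simp [h1, h2]

/-- The squared importance weight `1 / p j ^ 2` is met only with probability `p j`; this leaves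
order `1 / c` instead of `1 / c ^ 2`. -/
lemma sum_mul_estRegret_sq_le {c : ℝ} (hc : 0 < c) (hc1 : c ≤ 1) {p : Fin N → ℝ}
    (hp : ∀ i, c ≤ p i) (hp1 : ∀ i, p i ≤ 1) {r : Fin N → ℝ} (hr : ∀ i, r i ∈ Set.Icc (0 : ℝ) 1)
    (i j : Fin N) :
    ∑ a, p a * estRegret p a (r a) i j ^ 2 ≤ 2 / c := by
  have hp0 : ∀ i, 0 < p i := fun i => hc.trans_le (hp i)
  have h1 : ∑ a, p a * estRegret p a (r a) i j ^ 2 ≤ ∑ a, p a *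
      ((if j = a then (p i * (r j / p j)) ^ 2 else 0) + (if i = a then r i ^ 2 else 0)) :=
    Finset.sum_le_sum fun a _ => mul_le_mul_of_nonneg_left (estRegret_sq_le hp0 i j a) (hp0 a).le
  refine h1.trans ?_
  simp only [mul_add, Finset.sum_add_distrib, mul_ite, mul_zero, Finset.sum_ite_eq,
    Finset.mem_univ, if_true]
  have e1 : p j * (p i * (r j / p j)) ^ 2 = (p i * r j) ^ 2 / p j := by
    have := (hp0 j).ne'
    field_simp
  have hsq : ∀ {x : ℝ}, 0 ≤ x → x ≤ 1 → x ^ 2 ≤ 1 := fun h0 h1 => pow_le_one₀ h0 h1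
  have e2 : (p i * r j) ^ 2 / p j ≤ 1 / c :=
    div_le_div₀ zero_le_one (hsq (mul_nonneg (hp0 i).le (hr j).1)
      (mul_le_one₀ (hp1 i) (hr j).1 (hr j).2)) hc (hp j)
  have e3 : p i * r i ^ 2 ≤ 1 / c :=
    (mul_le_one₀ (hp1 i) (sq_nonneg _) (hsq (hr i).1 (hr i).2)).trans ((one_le_div hc).2 hc1)
  rw [e1]
  calc _ ≤ 1 / c + 1 / c := add_le_add e2 e3
    _ = 2 / c := by ring

-- The two bounds are asymmetric: the loss term carries the factor `p i`, which cancels its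
-- importance weight. Hence subtracting an estimated regret in an exponent raises it by at most `1`.
lemma estRegret_le {c : ℝ} (hc : 0 < c) {p : Fin N → ℝ}
    (hp : ∀ i, c ≤ p i) (hp1 : ∀ i, p i ≤ 1) {r : Fin N → ℝ} (hr : ∀ i, r i ∈ Set.Icc (0 : ℝ) 1)
    (a i j : Fin N) : estRegret p a (r a) i j ≤ 1 / c ∧ -1 ≤ estRegret p a (r a) i j := by
  have hp0 : ∀ i, 0 < p i := fun i => hc.trans_le (hp i)
  have hi := (hp0 i).ne'
  have h : p i * (r i / p i) = r i := by field_simp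
  have e2 : p i * (r j / p j) ≤ 1 / c := by
    rw [← mul_div_assoc]
    exact div_le_div₀ zero_le_one (mul_le_one₀ (hp1 i) (hr j).1 (hr j).2) hc (hp j)
  have e3 : 0 ≤ p i * (r j / p j) := mul_nonneg (hp0 i).le (div_nonneg (hr j).1 (hp0 j).le)
  have e4 : 0 < 1 / c := by positivity
  have h0 := hr i
  rw [estRegret_eq, h]
  constructor <;> split_ifs <;> linarith [h0.1, h0.2]

lemma mul_sub_mem {x y z : ℝ} (hx : x ∈ Set.Icc (0 : ℝ) 1) (hy : y ∈ Set.Icc (0 : ℝ) 1)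
    (hz : z ∈ Set.Icc (0 : ℝ) 1) : |x * (y - z)| ≤ 1 := by
  rw [abs_mul]
  refine mul_le_one₀ (by rw [abs_of_nonneg hx.1]; exact hx.2) (abs_nonneg _)
    (abs_le.2 ⟨by linarith [hy.1, hz.2], by linarith [hy.2, hz.1]⟩)

/-! ### Growth of the potential in one round -/

/-- The factor by which the potential of the pair `(i, j)` grows in a round in which the action
`a` is drawn from `p` and `r` is the reward vector. -/
def growth (η : ℝ) (δ : Fin N → Fin N → ℝ) (p r : Fin N → ℝ) (i j a : Fin N) : ℝ :=
  (∑ e ∈ (Finset.univ : Finset (Fin N)).offDiag,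
    δ e.1 e.2 * Real.exp (η * estRegret p a (r a) e.1 e.2)) *
    Real.exp (η * (p i * (r j - r i) - estRegret p a (r a) i j))

lemma growth_nonneg {η : ℝ} {δ : Fin N → Fin N → ℝ} (h0 : ∀ i j, 0 ≤ δ i j) (p r : Fin N → ℝ)
    (i j a : Fin N) : 0 ≤ growth η δ p r i j a :=
  mul_nonneg (Finset.sum_nonneg fun _ _ => mul_nonneg (h0 _ _) (Real.exp_pos _).le)
    (Real.exp_pos _).le

/-- Both factors depend on the same draw `a` and are correlated. Merging the exponents lets a single
second-order expansion handle them. -/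
lemma growth_eq (η : ℝ) (δ : Fin N → Fin N → ℝ) (p r : Fin N → ℝ) (i j a : Fin N) :
    growth η δ p r i j a = ∑ e ∈ (Finset.univ : Finset (Fin N)).offDiag, δ e.1 e.2 *
      Real.exp (η * (estRegret p a (r a) e.1 e.2 +
        (p i * (r j - r i) - estRegret p a (r a) i j))) := by
  rw [growth, Finset.sum_mul]
  refine Finset.sum_congr rfl fun e _ => ?_
  rw [mul_assoc, ← Real.exp_add, ← mul_add]

section OneRound

variable {c u : ℝ} (hc : 0 < c) (hu : 0 ≤ u) (hu1 : u ≤ 1) (hc2 : c ≤ 1 / 2)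
  {p : Fin N → ℝ} (hp : ∀ i, c ≤ p i) (hps : ∑ i, p i = 1)
  {r : Fin N → ℝ} (hr : ∀ i, r i ∈ Set.Icc (0 : ℝ) 1)
  {δ : Fin N → Fin N → ℝ} (h0 : ∀ i j, 0 ≤ δ i j)
  (hδ : ∑ e ∈ (Finset.univ : Finset (Fin N)).offDiag, δ e.1 e.2 = 1)

include hc hp hps in
lemma le_one_of_sum_eq_one (i : Fin N) : p i ≤ 1 := by
  rw [← hps]
  exact Finset.single_le_sum (f := p) (fun i _ => hc.le.trans (hp i)) (Finset.mem_univ i)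

include hc hu hu1 hc2 hp hps hr in
-- Only an upper bound is needed, since the quadratic estimate of `exp` holds for every argument at
-- most `2`.
lemma exponent_le (a i j k l : Fin N) :
    u * c * (estRegret p a (r a) k l + (p i * (r j - r i) - estRegret p a (r a) i j)) ≤ 2 := by
  have hp1 := le_one_of_sum_eq_one hc hp hps
  have h1 := (estRegret_le hc hp hp1 hr a k l).1
  have h2 := (estRegret_le hc hp hp1 hr a i j).2
  have h3 := (abs_le.1 (mul_sub_mem ⟨hc.le.trans (hp i), hp1 i⟩ (hr j) (hr i))).2
  calc _ ≤ u * c * (1 / c + 2) := mul_le_mul_of_nonneg_left (by linarith) (by positivity)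
    _ = u * (1 + 2 * c) := by field_simp
    _ ≤ 1 * 2 := mul_le_mul hu1 (by linarith) (by positivity) zero_le_one
    _ = 2 := one_mul _

include hc hu hu1 hc2 hp hps hr h0 hδ in
lemma growth_le (i j a : Fin N) : growth (u * c) δ p r i j a ≤ Real.exp 2 := by
  rw [growth_eq]
  calc _ ≤ ∑ e ∈ (Finset.univ : Finset (Fin N)).offDiag, δ e.1 e.2 * Real.exp 2 :=
        Finset.sum_le_sum fun e _ => mul_le_mul_of_nonneg_left
          (Real.exp_le_exp.2 (exponent_le hc hu hu1 hc2 hp hps hr a i j e.1 e.2)) (h0 _ _)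
    _ = _ := by rw [← Finset.sum_mul, hδ, one_mul]

include hc hu hu1 hc2 hp hps hr in
lemma sum_mul_exp_le (i j k l : Fin N) :
    ∑ a, p a * Real.exp (u * c * (estRegret p a (r a) k l +
        (p i * (r j - r i) - estRegret p a (r a) i j))) ≤
      1 + u * c * (p k * (r l - r k)) + 16 * u ^ 2 * c := by
  have hp1 := le_one_of_sum_eq_one hc hp hps
  have hp0 : ∀ i, 0 < p i := fun i => hc.trans_le (hp i)
  set ρ := p i * (r j - r i) with hρ
  set X : Fin N → ℝ := fun a => estRegret p a (r a) k l with hX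
  set Y : Fin N → ℝ := fun a => estRegret p a (r a) i j with hY
  have mX : ∑ a, p a * X a = p k * (r l - r k) := sum_mul_estRegret hp0 r k l
  have mY : ∑ a, p a * Y a = ρ := sum_mul_estRegret hp0 r i j
  have sX : ∑ a, p a * X a ^ 2 ≤ 2 / c :=
    sum_mul_estRegret_sq_le hc (by linarith) hp hp1 hr k l
  have sY : ∑ a, p a * Y a ^ 2 ≤ 2 / c :=
    sum_mul_estRegret_sq_le hc (by linarith) hp hp1 hr i j
  have hpt : ∀ a, p a * Real.exp (u * c * (X a + (ρ - Y a))) ≤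
      p a + u * c * (p a * X a + p a * ρ - p a * Y a) +
        (u * c) ^ 2 * (4 * (p a * X a ^ 2) + 4 * (p a * Y a ^ 2 - 2 * ρ * (p a * Y a)
          + p a * ρ ^ 2)) := by
    intro a
    have h1 := exp_le_one_add_two_sq (exponent_le hc hu hu1 hc2 hp hps hr a i j k l)
    -- This is `2 * (x + y) ^ 2 ≤ 4 * x ^ 2 + 4 * y ^ 2`, which separates the two estimators.
    have h2 : 2 * (u * c * (X a + (ρ - Y a))) ^ 2 ≤
        (u * c) ^ 2 * (4 * X a ^ 2 + 4 * (Y a - ρ) ^ 2) := by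
      have : 0 ≤ (u * c) ^ 2 * (X a - (ρ - Y a)) ^ 2 := by positivity
      nlinarith
    calc _ ≤ p a * (1 + u * c * (X a + (ρ - Y a)) +
          (u * c) ^ 2 * (4 * X a ^ 2 + 4 * (Y a - ρ) ^ 2)) :=
          mul_le_mul_of_nonneg_left (h1.trans (by linarith)) (hp0 a).le
      _ = _ := by ring
  refine (Finset.sum_le_sum fun a _ => hpt a).trans ?_
  simp only [Finset.sum_add_distrib, Finset.sum_sub_distrib, ← Finset.mul_sum, ← Finset.sum_mul,
    hps, mX, mY]
  -- The centred term contributes a variance, which is at most the second moment; each of the two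
  -- parts is at most `4 * (2 / c)`.
  have h3 : 4 * ∑ a, p a * X a ^ 2 + 4 * (∑ a, p a * Y a ^ 2 - 2 * ρ * ρ + 1 * ρ ^ 2) ≤ 16 / c := by
    have e : 16 / c = 4 * (2 / c) + 4 * (2 / c) := by ring
    nlinarith [sq_nonneg ρ]
  have h4 : (u * c) ^ 2 * (16 / c) = 16 * u ^ 2 * c := by field_simp
  have h5 := mul_le_mul_of_nonneg_left h3 (sq_nonneg (u * c))
  linarith

include hc hu hu1 hc2 hp hps hr h0 hδ in
/-- The conditional expectation of the growth of the potential in one round. -/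
lemma sum_mul_growth_le (hcu : c ≤ u) {γ : ℝ} {q : Fin N → ℝ} (hq : IsFixedPoint δ q)
    (hpq : ∀ i, p i = (1 - γ) * q i + c) (i j : Fin N) :
    ∑ a, p a * growth (u * c) δ p r i j a ≤ Real.exp (17 * u ^ 3) := by
  have h1 : ∑ a, p a * growth (u * c) δ p r i j a =
      ∑ e ∈ (Finset.univ : Finset (Fin N)).offDiag, δ e.1 e.2 * ∑ a, p a *
        Real.exp (u * c * (estRegret p a (r a) e.1 e.2 +
        (p i * (r j - r i) - estRegret p a (r a) i j))) := by
    simp only [growth_eq, Finset.mul_sum]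
    rw [Finset.sum_comm]
    exact Finset.sum_congr rfl fun e _ => Finset.sum_congr rfl fun a _ => by ring
  have h2 : ∀ e ∈ (Finset.univ : Finset (Fin N)).offDiag,
      δ e.1 e.2 * (1 + u * c * (p e.1 * (r e.2 - r e.1)) + 16 * u ^ 2 * c) ≤
      δ e.1 e.2 * (1 + u * c ^ 2 + 16 * u ^ 2 * c) +
        u * c * (1 - γ) * (δ e.1 e.2 * (q e.1 * (r e.2 - r e.1))) := by
    intro e _
    -- The exploration part `c` of `p` is not covered by the fixed point identity; its regret is
    -- bounded by `c`.
    have h3 : δ e.1 e.2 * (u * c * c) * (r e.2 - r e.1) ≤ δ e.1 e.2 * (u * c * c) * 1 :=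
      mul_le_mul_of_nonneg_left (by linarith [(hr e.1).1, (hr e.2).2])
        (mul_nonneg (h0 _ _) (by positivity))
    rw [hpq e.1]
    nlinarith
  calc _ ≤ ∑ e ∈ (Finset.univ : Finset (Fin N)).offDiag,
        (δ e.1 e.2 * (1 + u * c ^ 2 + 16 * u ^ 2 * c) +
        u * c * (1 - γ) * (δ e.1 e.2 * (q e.1 * (r e.2 - r e.1)))) := by
        rw [h1]
        exact Finset.sum_le_sum fun e he => (mul_le_mul_of_nonneg_left
          (sum_mul_exp_le hc hu hu1 hc2 hp hps hr i j e.1 e.2) (h0 _ _)).trans (h2 e he)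
    _ = u * c ^ 2 + 16 * u ^ 2 * c + 1 := by
        rw [Finset.sum_add_distrib, ← Finset.sum_mul, ← Finset.mul_sum, hδ,
          hq.sum_regret_eq_zero hδ r]
        ring
    _ ≤ 17 * u ^ 3 + 1 := by
        have h4 : u * c ^ 2 ≤ u * u ^ 2 := by gcongr
        have h5 : u ^ 2 * c ≤ u ^ 2 * u := by gcongr
        nlinarith
    _ ≤ _ := Real.add_one_le_exp _

end OneRound

/-! ### Arithmetic of the parameters and the rate -/

lemma log_natCast_ge_half {N : ℕ} (hN : 2 ≤ N) : 1 / 2 ≤ Real.log N := by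
  have h2 : Real.log 2 ≤ Real.log N := Real.log_le_log (by norm_num) (by exact_mod_cast hN)
  linarith [Real.log_two_gt_d9]

lemma rpow_two_thirds_cube {x : ℝ} (hx : 0 ≤ x) : (x ^ (2 / 3 : ℝ)) ^ 3 = x ^ 2 := by
  rw [← Real.rpow_natCast, ← Real.rpow_mul hx, ← Real.rpow_natCast]
  norm_num

lemma etaParam_cube {N n : ℕ} : etaParam N n ^ 3 = (Real.log N / (2 * N * n)) ^ 2 :=
  rpow_two_thirds_cube (div_nonneg (Real.log_natCast_nonneg N) (by positivity))

lemma gammaParam_cube {N n : ℕ} : gammaParam N n ^ 3 = (N : ℝ) ^ 2 * Real.log N / (4 * n) := by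
  have h : 0 ≤ (N : ℝ) ^ 2 * Real.log N / (4 * n) :=
    div_nonneg (mul_nonneg (by positivity) (Real.log_natCast_nonneg N)) (by positivity)
  rw [gammaParam, ← Real.rpow_natCast, ← Real.rpow_mul h]
  norm_num

lemma rate_cube {N n : ℕ} : rate N n ^ 3 = (n * (N : ℝ) ^ 2 * Real.log N) ^ 2 :=
  rpow_two_thirds_cube (mul_nonneg (by positivity) (Real.log_natCast_nonneg N))

lemma rate_nonneg (N n : ℕ) : 0 ≤ rate N n :=
  Real.rpow_nonneg (mul_nonneg (by positivity) (Real.log_natCast_nonneg N)) _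

lemma etaParam_pos {N n : ℕ} (hN : 2 ≤ N) (hn : 0 < n) : 0 < etaParam N n := by
  have := log_natCast_ge_half hN
  exact Real.rpow_pos_of_pos (div_pos (by linarith) (by positivity)) _

lemma gammaParam_pos {N n : ℕ} (hN : 2 ≤ N) (hn : 0 < n) : 0 < gammaParam N n := by
  have := log_natCast_ge_half hN
  exact Real.rpow_pos_of_pos (div_pos (mul_pos (by positivity) (by linarith)) (by positivity)) _

/-- The relations between the parameters, in terms of `c = γ / N` and `u = η / c`. -/
lemma exists_params {N n : ℕ} (hN : 2 ≤ N) (hn : 0 < n) (hγ : gammaParam N n ≤ 1) :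
    ∃ c u : ℝ, gammaParam N n / N = c ∧ etaParam N n = u * c ∧ 0 < c ∧ 0 ≤ u ∧ u ≤ 1 ∧
      c ≤ 1 / 2 ∧ c ≤ u ∧ n * u ^ 3 ≤ Real.log N / 2 := by
  have hL := log_natCast_ge_half hN
  have hN' : (2 : ℝ) ≤ N := by exact_mod_cast hN
  have hn' : (0 : ℝ) < n := by exact_mod_cast hn
  have hg := gammaParam_pos hN hn
  have he := etaParam_pos hN hn
  have hc : 0 < gammaParam N n / N := by positivity
  have hu : 0 < etaParam N n / (gammaParam N n / N) := by positivity
  have hu3 : (etaParam N n / (gammaParam N n / N)) ^ 3 = Real.log N / (n * N) := by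
    rw [div_pow, div_pow, etaParam_cube, gammaParam_cube]
    have : Real.log N ≠ 0 := by linarith
    field_simp
    norm_num
  -- Together with `hu3` this says `u ^ 3 = 4 * c ^ 3`: the two parameters are balanced, so `c ≤ u`,
  -- and `c ≤ 1 / 2` forces `u ≤ 1`.
  have hc3 : 4 * (gammaParam N n / N) ^ 3 = Real.log N / (n * N) := by
    rw [div_pow, gammaParam_cube]
    field_simp
  have hc2 : gammaParam N n / N ≤ 1 / 2 := by
    rw [div_le_div_iff₀ (by positivity) (by norm_num)]; linarith
  refine ⟨_, _, rfl, (div_mul_cancel₀ _ hc.ne').symm, hc, hu.le, ?_, hc2, ?_, ?_⟩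
  · refine (pow_le_pow_iff_left₀ hu.le zero_le_one three_ne_zero).1 ?_
    have := pow_le_pow_left₀ hc.le hc2 3
    rw [hu3]
    norm_num at this ⊢
    linarith
  · refine (pow_le_pow_iff_left₀ hc.le hu.le three_ne_zero).1 ?_
    have : 0 < (gammaParam N n / N) ^ 3 := by positivity
    linarith
  · rw [hu3]
    have : n * (Real.log N / (n * N)) = Real.log N / N := by field_simp
    rw [this]
    exact div_le_div_of_nonneg_left (by linarith) (by norm_num) hN'

lemma log_div_etaParam_le {N n : ℕ} (hN : 2 ≤ N) (hn : 0 < n) :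
    Real.log N / etaParam N n ≤ 2 * rate N n := by
  have hL := log_natCast_ge_half hN
  have hN' : (2 : ℝ) ≤ N := by exact_mod_cast hN
  have hn' : (0 : ℝ) < n := by exact_mod_cast hn
  have he := etaParam_pos hN hn
  refine (pow_le_pow_iff_left₀ (by positivity) (by have := rate_nonneg N n; positivity)
    three_ne_zero).1 ?_
  rw [div_pow, mul_pow, etaParam_cube, rate_cube]
  have h0 : Real.log N ≠ 0 := by linarith
  have e : Real.log N ^ 3 / (Real.log N / (2 * N * n)) ^ 2 = 4 * N ^ 2 * n ^ 2 * Real.log N := by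
    field_simp
    norm_num
  rw [e]
  -- The cubes of the two sides differ by the factor `2 * N ^ 2 * log N`, which is pure slack in the
  -- rate.
  have h1 : 1 ≤ 2 * (N : ℝ) ^ 2 * Real.log N := by nlinarith
  have h2 : 0 ≤ 4 * (N : ℝ) ^ 2 * n ^ 2 * Real.log N := by positivity
  nlinarith [mul_le_mul_of_nonneg_left h1 h2]

/-- Here `γ > 1` means `4 * n < N ^ 2 * log N`, so a regret linear in `n` is still within the rate.
-/
lemma natCast_le_rate {N n : ℕ} (hN : 2 ≤ N) (hn : 0 < n) (hγ : 1 < gammaParam N n) :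
    (n : ℝ) ≤ rate N n := by
  have hL := log_natCast_ge_half hN
  have hN' : (2 : ℝ) ≤ N := by exact_mod_cast hN
  have hn' : (0 : ℝ) < n := by exact_mod_cast hn
  refine (pow_le_pow_iff_left₀ hn'.le (rate_nonneg N n) three_ne_zero).1 ?_
  have h1 := one_lt_pow₀ hγ three_ne_zero
  rw [gammaParam_cube, one_lt_div (by positivity)] at h1
  rw [rate_cube]
  have h3 : 1 ≤ (N : ℝ) ^ 2 * Real.log N := by nlinarith
  have h4 : (n : ℝ) ≤ ((N : ℝ) ^ 2 * Real.log N) ^ 2 := by nlinarith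
  nlinarith [mul_le_mul_of_nonneg_left h4 (sq_nonneg (n : ℝ))]

lemma eventually_gammaParam_le_one (N : ℕ) : ∀ᶠ n : ℕ in atTop, gammaParam N n ≤ 1 := by
  filter_upwards [tendsto_natCast_atTop_atTop.eventually_ge_atTop ((N : ℝ) ^ 2 * Real.log N),
    eventually_gt_atTop 0] with n h1 h2
  have hn' : (0 : ℝ) < n := by exact_mod_cast h2
  refine Real.rpow_le_one (div_nonneg (mul_nonneg (by positivity) (Real.log_natCast_nonneg N))
    (by positivity)) ?_ (by norm_num)
  rw [div_le_one (by positivity)]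
  linarith

/-! ### Pathwise properties of a run -/

section Run

variable {K : ℕ} {N : Fin K → ℕ} {Ω : Type*}

/-- The accumulated estimated regrets of the rounds before round `t`. -/
def estimatedRegret (η γ : ℝ) (k : Fin K)
    (g : ℕ → Ω → (∀ l, Fin (N l)) → ℝ) (I : ℕ → Ω → ∀ l, Fin (N l)) (t : ℕ) (ω : Ω) :
    Fin (N k) → Fin (N k) → ℝ :=
  (state η γ (fun s => I s ω k) (fun s => g s ω (I s ω)) t).2

/-- The accumulated regret of the rounds before round `t` for not having replaced `i` by `j`. -/
def pairRegret (η γ : ℝ) (k : Fin K)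
    (g : ℕ → Ω → (∀ l, Fin (N l)) → ℝ) (I : ℕ → Ω → ∀ l, Fin (N l)) (t : ℕ) (ω : Ω)
    (i j : Fin (N k)) : ℝ :=
  ∑ s ∈ Finset.range t, strategy η γ k g I s ω i * (rewardOf k g I s ω j - rewardOf k g I s ω i)

/-- An upper bound for `exp (η * pairRegret)` that is almost a supermartingale. -/
def potential (η γ : ℝ) (k : Fin K)
    (g : ℕ → Ω → (∀ l, Fin (N l)) → ℝ) (I : ℕ → Ω → ∀ l, Fin (N l)) (i j : Fin (N k))
    (t : ℕ) (ω : Ω) : ℝ :=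
  (∑ e ∈ (Finset.univ : Finset (Fin (N k))).offDiag,
    Real.exp (η * estimatedRegret η γ k g I t ω e.1 e.2)) *
    Real.exp (η * (pairRegret η γ k g I t ω i j - estimatedRegret η γ k g I t ω i j))

variable {η γ : ℝ} {k : Fin K}
  {g : ℕ → Ω → (∀ l, Fin (N l)) → ℝ} {I : ℕ → Ω → ∀ l, Fin (N l)}

lemma estimatedRegret_succ (t : ℕ) (ω : Ω) (i j : Fin (N k)) :
    estimatedRegret η γ k g I (t + 1) ω i j = estimatedRegret η γ k g I t ω i j +
      estRegret (strategy η γ k g I t ω) (I t ω k) (rewardOf k g I t ω (I t ω k)) i j := by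
  rw [rewardOf, Function.update_eq_self]
  rfl

lemma potential_nonneg (i j : Fin (N k)) (t : ℕ) (ω : Ω) : 0 ≤ potential η γ k g I i j t ω := by
  unfold potential; positivity

lemma potential_zero (i j : Fin (N k)) (ω : Ω) :
    potential η γ k g I i j 0 ω = (N k : ℝ) * (N k - 1) := by
  simp only [potential, estimatedRegret, state, pairRegret, Finset.range_zero, Finset.sum_empty,
    mul_zero, sub_zero, Real.exp_zero, Finset.sum_const, Finset.offDiag_card, Finset.card_univ,
    Fintype.card_fin, nsmul_eq_mul, mul_one]
  rw [Nat.cast_sub (Nat.le_mul_self _)]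
  push_cast; ring

lemma potential_succ (i j : Fin (N k)) (t : ℕ) (ω : Ω) :
    potential η γ k g I i j (t + 1) ω = potential η γ k g I i j t ω *
      growth η (pairWeight η (estimatedRegret η γ k g I t ω)) (strategy η γ k g I t ω)
        (rewardOf k g I t ω) i j (I t ω k) := by
  have hW : 0 < ∑ e ∈ (Finset.univ : Finset (Fin (N k))).offDiag,
      Real.exp (η * estimatedRegret η γ k g I t ω e.1 e.2) ∨
      (Finset.univ : Finset (Fin (N k))).offDiag = ∅ := by
    rcases (Finset.univ : Finset (Fin (N k))).offDiag.eq_empty_or_nonempty with h | h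
    · exact Or.inr h
    · exact Or.inl (Finset.sum_pos (fun _ _ => Real.exp_pos _) h)
  rcases hW with hW | hW
  swap
  -- Without pairs the potential is an empty sum, and both sides are zero.
  · simp [potential, hW]
  unfold potential growth
  have e1 : ∀ e : Fin (N k) × Fin (N k),
      Real.exp (η * estimatedRegret η γ k g I (t + 1) ω e.1 e.2) =
      (∑ e ∈ (Finset.univ : Finset (Fin (N k))).offDiag,
        Real.exp (η * estimatedRegret η γ k g I t ω e.1 e.2)) *
      (pairWeight η (estimatedRegret η γ k g I t ω) e.1 e.2 *
        Real.exp (η * estRegret (strategy η γ k g I t ω) (I t ω k)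
          (rewardOf k g I t ω (I t ω k)) e.1 e.2)) := by
    intro e
    rw [estimatedRegret_succ, pairWeight, mul_add, Real.exp_add]
    field_simp
  have e2 : η * (pairRegret η γ k g I (t + 1) ω i j - estimatedRegret η γ k g I (t + 1) ω i j) =
      η * (pairRegret η γ k g I t ω i j - estimatedRegret η γ k g I t ω i j) +
      η * (strategy η γ k g I t ω i * (rewardOf k g I t ω j - rewardOf k g I t ω i) -
        estRegret (strategy η γ k g I t ω) (I t ω k)
          (rewardOf k g I t ω (I t ω k)) i j) := by
    rw [estimatedRegret_succ, pairRegret, Finset.sum_range_succ, ← pairRegret]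
    ring
  rw [e2, Real.exp_add, Finset.sum_congr rfl fun e _ => e1 e, ← Finset.mul_sum]
  ring

lemma exp_pairRegret_le_potential {i j : Fin (N k)} (hij : i ≠ j) (t : ℕ) (ω : Ω) :
    Real.exp (η * pairRegret η γ k g I t ω i j) ≤ potential η γ k g I i j t ω := by
  have h := Finset.single_le_sum (s := (Finset.univ : Finset (Fin (N k))).offDiag)
    (f := fun e => Real.exp (η * estimatedRegret η γ k g I t ω e.1 e.2))
    (fun _ _ => (Real.exp_pos _).le) (a := (i, j)) (by simpa using hij)
  calc _ = Real.exp (η * estimatedRegret η γ k g I t ω i j) *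
      Real.exp (η * (pairRegret η γ k g I t ω i j - estimatedRegret η γ k g I t ω i j)) := by
        rw [← Real.exp_add]; congr 1; ring
    _ ≤ _ := mul_le_mul_of_nonneg_right h (Real.exp_pos _).le

lemma isFixedPoint_uniform {N : ℕ} (hN : 2 ≤ N) (η : ℝ) :
    IsFixedPoint (pairWeight (N := N) η fun _ _ => 0) (fun _ => 1 / (N : ℝ)) := by
  rw [isFixedPoint_iff _ (sum_pairWeight hN η _)]
  have : (N : ℝ) ≠ 0 := by positivity
  refine ⟨⟨fun i => by positivity, by simp [this]⟩, fun l => Finset.sum_eq_zero fun i _ => ?_⟩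
  by_cases h : l = i
  · simp [h]
  · simp [h, Ne.symm h, pairWeight]

lemma exists_fixedPoint_strategy (hN : 2 ≤ N k) (t : ℕ) (ω : Ω) :
    ∃ q, IsFixedPoint (pairWeight η (estimatedRegret η γ k g I t ω)) q ∧
      ∀ i, strategy η γ k g I t ω i = (1 - γ) * q i + γ / N k := by
  cases t with
  -- The uniform start solves the fixed point equation for zero regrets and is unchanged by mixing
  -- with the uniform distribution, so the first round needs no separate treatment.
  | zero =>
    refine ⟨_, isFixedPoint_uniform hN η, fun i => ?_⟩
    simp only [strategy, state]
    ring
  | succ t => exact ⟨_, (isFixedPoint_pairWeight_iff hN _ _ _).2 rfl, fun i => rfl⟩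

lemma div_le_strategy (hN : 2 ≤ N k) (hγ : γ ≤ 1) (t : ℕ) (ω : Ω) (i : Fin (N k)) :
    γ / N k ≤ strategy η γ k g I t ω i := by
  obtain ⟨q, hq, h⟩ := exists_fixedPoint_strategy (η := η) (γ := γ) (g := g) (I := I) hN t ω
  rw [h]
  have := mul_nonneg (sub_nonneg.2 hγ) (hq.1.1 i)
  linarith

lemma sum_strategy (hN : 2 ≤ N k) (t : ℕ) (ω : Ω) : ∑ i, strategy η γ k g I t ω i = 1 := by
  obtain ⟨q, hq, h⟩ := exists_fixedPoint_strategy (η := η) (γ := γ) (g := g) (I := I) hN t ω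
  have : (N k : ℝ) ≠ 0 := by positivity
  simp only [h, Finset.sum_add_distrib, ← Finset.mul_sum, hq.1.2]
  simp
  field_simp
  ring

lemma internalRegret_eq (n : ℕ) (ω : Ω) : internalRegret n k g I ω =
    ⨆ e : Fin (N k) × Fin (N k),
      pairRegret (etaParam (N k) n) (gammaParam (N k) n) k g I n ω e.1 e.2 := rfl

lemma internalRegret_nonneg (n : ℕ) (ω : Ω) : 0 ≤ internalRegret n k g I ω := by
  rw [internalRegret_eq]
  rcases isEmpty_or_nonempty (Fin (N k)) with h | ⟨⟨i⟩⟩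
  · rw [Real.iSup_of_isEmpty]
  · refine le_ciSup_of_le (Set.finite_range _).bddAbove (i, i) ?_
    simp [pairRegret]

lemma internalRegret_eq_zero (h : N k ≤ 1) (n : ℕ) (ω : Ω) : internalRegret n k g I ω = 0 := by
  have : Subsingleton (Fin (N k)) := Fin.subsingleton_iff_le_one.2 h
  rw [internalRegret_eq]
  have h0 : ∀ e : Fin (N k) × Fin (N k),
      pairRegret (etaParam (N k) n) (gammaParam (N k) n) k g I n ω e.1 e.2 = 0 := fun e => by
    rw [Subsingleton.elim e.2 e.1]; simp [pairRegret]
  simp [h0]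

lemma exp_internalRegret_le (hN : 2 ≤ N k) (n : ℕ) (ω : Ω) :
    Real.exp (etaParam (N k) n * internalRegret n k g I ω) ≤
      1 + ∑ e ∈ (Finset.univ : Finset (Fin (N k))).offDiag,
        potential (etaParam (N k) n) (gammaParam (N k) n) k g I e.1 e.2 n ω := by
  have : Nonempty (Fin (N k)) := ⟨⟨0, by omega⟩⟩
  rw [internalRegret_eq]
  obtain ⟨⟨i, j⟩, he⟩ := exists_eq_ciSup_of_finite (f := fun e : Fin (N k) × Fin (N k) =>
    pairRegret (etaParam (N k) n) (gammaParam (N k) n) k g I n ω e.1 e.2)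
  rw [← he]
  have hnn : ∀ e ∈ (Finset.univ : Finset (Fin (N k))).offDiag, 0 ≤
      potential (etaParam (N k) n) (gammaParam (N k) n) k g I e.1 e.2 n ω :=
    fun e _ => potential_nonneg _ _ _ _
  by_cases hij : i = j
  · subst hij
    simp only [pairRegret, sub_self, mul_zero, Finset.sum_const_zero, Real.exp_zero]
    linarith [Finset.sum_nonneg hnn]
  · have h1 := Finset.single_le_sum hnn (a := (i, j)) (by simpa using hij)
    have h2 := exp_pairRegret_le_potential (η := etaParam (N k) n) (γ := gammaParam (N k) n)
      (g := g) (I := I) hij n ω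
    dsimp only at h1 h2 ⊢
    linarith

end Run

/-! ### Measurability and integrability along a run -/

section Probability

variable {K : ℕ} {N : Fin K → ℕ} {Ω : Type*} {m : MeasurableSpace Ω} {μ : Measure Ω}
  {ℱ : Filtration ℕ m} {n : ℕ} {k : Fin K}
  {g : ℕ → Ω → (∀ l, Fin (N l)) → ℝ} {I : ℕ → Ω → ∀ l, Fin (N l)}

lemma aestronglyMeasurable_finset_sum {ι : Type*} {m' : MeasurableSpace Ω} {f : ι → Ω → ℝ}
    (s : Finset ι) (hf : ∀ i ∈ s, AEStronglyMeasurable[m'] (f i) μ) :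
    AEStronglyMeasurable[m'] (fun ω => ∑ i ∈ s, f i ω) μ := by
  classical
  induction s using Finset.induction_on with
  | empty => simpa using stronglyMeasurable_const.aestronglyMeasurable
  | insert a s ha ih =>
    simp only [Finset.sum_insert ha]
    exact (hf a (Finset.mem_insert_self a s)).add
      (ih fun i hi => hf i (Finset.mem_insert_of_mem hi))

namespace IsRun

lemma rewardOf_mem (h : IsRun μ ℱ n k g I) {t : ℕ} (ht : t < n) (ω : Ω) (i : Fin (N k)) :
    rewardOf k g I t ω i ∈ Set.Icc (0 : ℝ) 1 := h.reward_mem t ht ω _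

lemma aestronglyMeasurable_rewardOf (h : IsRun μ ℱ n k g I) {t : ℕ} (ht : t < n)
    (i : Fin (N k)) : AEStronglyMeasurable[ℱ t] (fun ω => rewardOf k g I t ω i) μ :=
  (h.reward_meas t ht i).stronglyMeasurable.aestronglyMeasurable

/-- The fixed point is obtained by choice, and its measurable dependence on the weights is not
evident. It is not needed: the strategy agrees almost surely with a conditional expectation. -/
lemma aestronglyMeasurable_strategy (h : IsRun μ ℱ n k g I) {t : ℕ} (ht : t < n)
    (i : Fin (N k)) : AEStronglyMeasurable[ℱ t]
      (fun ω => strategy (etaParam (N k) n) (gammaParam (N k) n) k g I t ω i) μ :=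
  stronglyMeasurable_condExp.aestronglyMeasurable.congr (h.action_law t ht i)

lemma aestronglyMeasurable_estReward (h : IsRun μ ℱ n k g I) {t : ℕ} (ht : t < n)
    (i : Fin (N k)) : AEStronglyMeasurable[ℱ (t + 1)]
      (fun ω => estReward (strategy (etaParam (N k) n) (gammaParam (N k) n) k g I t ω) (I t ω k)
        (rewardOf k g I t ω (I t ω k)) i) μ := by
  have h1 : AEStronglyMeasurable[ℱ (t + 1)] (fun ω => rewardOf k g I t ω i /
      strategy (etaParam (N k) n) (gammaParam (N k) n) k g I t ω i) μ :=
    ((h.aestronglyMeasurable_rewardOf ht i).div₀ (h.aestronglyMeasurable_strategy ht i)).mono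
      (ℱ.mono t.le_succ)
  have h2 : AEStronglyMeasurable[ℱ (t + 1)]
      (Set.indicator {ω | I t ω k = i} fun _ => (1 : ℝ)) μ :=
    (stronglyMeasurable_const.indicator (h.action_meas t ht i)).aestronglyMeasurable
  refine (h2.mul h1).congr (Eventually.of_forall fun ω => ?_)
  by_cases hi : i = I t ω k
  · simp [estReward, hi]
  · simp [estReward, hi, Set.indicator, Ne.symm hi]

lemma aestronglyMeasurable_estimatedRegret (h : IsRun μ ℱ n k g I) {t : ℕ} (ht : t ≤ n)
    (i j : Fin (N k)) : AEStronglyMeasurable[ℱ t]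
      (fun ω => estimatedRegret (etaParam (N k) n) (gammaParam (N k) n) k g I t ω i j) μ := by
  induction t with
  | zero => exact stronglyMeasurable_const.aestronglyMeasurable
  | succ t ih =>
    simp only [estimatedRegret_succ]
    refine ((ih (by omega)).mono (ℱ.mono t.le_succ)).add ?_
    exact ((h.aestronglyMeasurable_strategy ht i).mono (ℱ.mono t.le_succ)).mul
      ((h.aestronglyMeasurable_estReward ht j).sub (h.aestronglyMeasurable_estReward ht i))

lemma aestronglyMeasurable_pairRegret (h : IsRun μ ℱ n k g I) {t : ℕ} (ht : t ≤ n)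
    (i j : Fin (N k)) : AEStronglyMeasurable[ℱ t]
      (fun ω => pairRegret (etaParam (N k) n) (gammaParam (N k) n) k g I t ω i j) μ := by
  refine aestronglyMeasurable_finset_sum _ fun s hs => ?_
  have hst : s < t := Finset.mem_range.1 hs
  have hsn : s < n := hst.trans_le ht
  exact ((h.aestronglyMeasurable_strategy hsn i).mul
    ((h.aestronglyMeasurable_rewardOf hsn j).sub (h.aestronglyMeasurable_rewardOf hsn i))).mono
    (ℱ.mono hst.le)

lemma aestronglyMeasurable_potential (h : IsRun μ ℱ n k g I) {t : ℕ} (ht : t ≤ n)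
    (i j : Fin (N k)) : AEStronglyMeasurable[ℱ t]
      (potential (etaParam (N k) n) (gammaParam (N k) n) k g I i j t) μ := by
  refine AEStronglyMeasurable.mul (aestronglyMeasurable_finset_sum _ fun e _ => ?_) ?_
  · exact Real.continuous_exp.comp_aestronglyMeasurable
      ((h.aestronglyMeasurable_estimatedRegret ht e.1 e.2).const_mul _)
  · exact Real.continuous_exp.comp_aestronglyMeasurable
      (((h.aestronglyMeasurable_pairRegret ht i j).sub
        (h.aestronglyMeasurable_estimatedRegret ht i j)).const_mul _)

lemma aestronglyMeasurable_growth (h : IsRun μ ℱ n k g I) {t : ℕ} (ht : t < n)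
    (i j a : Fin (N k)) : AEStronglyMeasurable[ℱ t]
      (fun ω => growth (etaParam (N k) n) (pairWeight (etaParam (N k) n)
        (estimatedRegret (etaParam (N k) n) (gammaParam (N k) n) k g I t ω))
        (strategy (etaParam (N k) n) (gammaParam (N k) n) k g I t ω)
        (rewardOf k g I t ω) i j a) μ := by
  have hp := h.aestronglyMeasurable_strategy ht
  have hr := h.aestronglyMeasurable_rewardOf ht
  have hR : ∀ i j, AEStronglyMeasurable[ℱ t] (fun ω => Real.exp (etaParam (N k) n *
      estimatedRegret (etaParam (N k) n) (gammaParam (N k) n) k g I t ω i j)) μ := fun i j =>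
    Real.continuous_exp.comp_aestronglyMeasurable
      ((h.aestronglyMeasurable_estimatedRegret ht.le i j).const_mul _)
  have hx : ∀ i, AEStronglyMeasurable[ℱ t] (fun ω => estReward
      (strategy (etaParam (N k) n) (gammaParam (N k) n) k g I t ω) a
      (rewardOf k g I t ω a) i) μ := fun i => by
    simp only [estReward]
    split_ifs
    · exact (hr a).div₀ (hp i)
    · exact stronglyMeasurable_const.aestronglyMeasurable
  have he : ∀ i j, AEStronglyMeasurable[ℱ t] (fun ω => estRegret
      (strategy (etaParam (N k) n) (gammaParam (N k) n) k g I t ω) a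
      (rewardOf k g I t ω a) i j) μ := fun i j => (hp i).mul ((hx j).sub (hx i))
  refine AEStronglyMeasurable.mul (aestronglyMeasurable_finset_sum _ fun e _ =>
    AEStronglyMeasurable.mul ?_ ?_) ?_
  · exact (hR e.1 e.2).div₀ (aestronglyMeasurable_finset_sum _ fun e _ => hR e.1 e.2)
  · exact Real.continuous_exp.comp_aestronglyMeasurable ((he e.1 e.2).const_mul _)
  · exact Real.continuous_exp.comp_aestronglyMeasurable
      ((((hp i).mul ((hr j).sub (hr i))).sub (he i j)).const_mul _)

/-- The source is the conditional law of the action and not the formula for the strategy, so the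
case `γ > 1` is included. -/
lemma ae_strategy_mem [IsProbabilityMeasure μ] (h : IsRun μ ℱ n k g I) :
    ∀ᵐ ω ∂μ, ∀ t < n, ∀ i,
      strategy (etaParam (N k) n) (gammaParam (N k) n) k g I t ω i ∈ Set.Icc (0 : ℝ) 1 := by
  simp only [ae_all_iff]
  intro t ht i
  have hm : MeasurableSet {ω | I t ω k = i} := ℱ.le _ _ (h.action_meas t ht i)
  have h0 : 0 ≤ᵐ[μ] μ[Set.indicator {ω | I t ω k = i} (fun _ => (1 : ℝ)) | ℱ t] :=
    condExp_nonneg (Eventually.of_forall fun ω => Set.indicator_nonneg (fun _ _ => zero_le_one) ω)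
  have h1 : μ[Set.indicator {ω | I t ω k = i} (fun _ => (1 : ℝ)) | ℱ t] ≤ᵐ[μ]
      μ[fun _ => (1 : ℝ) | ℱ t] :=
    condExp_mono ((integrable_const _).indicator hm) (integrable_const _)
      (Eventually.of_forall fun ω => Set.indicator_le_self' (fun _ _ => zero_le_one) ω)
  rw [condExp_const (ℱ.le t)] at h1
  filter_upwards [h0, h1, h.action_law t ht i] with ω h0 h1 h2
  rw [h2] at h0 h1
  exact ⟨h0, h1⟩

lemma ae_internalRegret_le [IsProbabilityMeasure μ] (h : IsRun μ ℱ n k g I) :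
    ∀ᵐ ω ∂μ, internalRegret n k g I ω ≤ n := by
  filter_upwards [h.ae_strategy_mem] with ω hω
  refine Real.iSup_le (fun e => ?_) (by positivity)
  refine (Finset.sum_le_card_nsmul _ _ 1 fun t ht => ?_).trans (by simp)
  have ht := Finset.mem_range.1 ht
  exact (abs_le.1 (mul_sub_mem (hω t ht _) (h.rewardOf_mem ht ω _) (h.rewardOf_mem ht ω _))).2

lemma aestronglyMeasurable_internalRegret (h : IsRun μ ℱ n k g I) :
    AEStronglyMeasurable (internalRegret n k g I) μ := by
  refine (AEMeasurable.iSup fun e : Fin (N k) × Fin (N k) => ?_).aestronglyMeasurable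
  exact ((h.aestronglyMeasurable_pairRegret le_rfl e.1 e.2).mono (ℱ.le n)).aemeasurable

lemma integrable_internalRegret [IsProbabilityMeasure μ] (h : IsRun μ ℱ n k g I) :
    Integrable (internalRegret n k g I) μ := by
  refine Integrable.of_bound h.aestronglyMeasurable_internalRegret n ?_
  filter_upwards [h.ae_internalRegret_le] with ω hω
  rwa [Real.norm_of_nonneg (internalRegret_nonneg _ _)]

/-! ### Expected growth of the potential -/

lemma integral_indicator_action_mul [IsProbabilityMeasure μ] (h : IsRun μ ℱ n k g I) {t : ℕ}
    (ht : t < n) (a : Fin (N k)) {f : Ω → ℝ} (hf : AEStronglyMeasurable[ℱ t] f μ)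
    (hfi : Integrable f μ) :
    ∫ ω, f ω * Set.indicator {ω | I t ω k = a} (fun _ => (1 : ℝ)) ω ∂μ =
      ∫ ω, f ω * strategy (etaParam (N k) n) (gammaParam (N k) n) k g I t ω a ∂μ := by
  have hm : MeasurableSet {ω | I t ω k = a} := ℱ.le _ _ (h.action_meas t ht a)
  have hi : Integrable (f * Set.indicator {ω | I t ω k = a} (fun _ => (1 : ℝ))) μ := by
    refine (hfi.indicator hm).congr (Eventually.of_forall fun ω => ?_)
    by_cases hω : I t ω k = a <;> simp [hω, Set.indicator]
  have h1 := condExp_mul_of_aestronglyMeasurable_left hf hi ((integrable_const _).indicator hm)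
  have h2 := integral_condExp (μ := μ) (ℱ.le t)
    (f := f * Set.indicator {ω | I t ω k = a} (fun _ => (1 : ℝ)))
  refine h2.symm.trans (integral_congr_ae ?_)
  filter_upwards [h1, h.action_law t ht a] with ω e1 e2
  rw [e1, Pi.mul_apply, e2]

/-- This crude bound, exponential in `t`, serves only to make the potential integrable. -/
lemma potential_le (h : IsRun μ ℱ n k g I) (hN : 2 ≤ N k) (hγ : gammaParam (N k) n ≤ 1)
    {t : ℕ} (ht : t ≤ n) (i j : Fin (N k)) (ω : Ω) :
    potential (etaParam (N k) n) (gammaParam (N k) n) k g I i j t ω ≤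
      (N k : ℝ) * (N k - 1) * Real.exp 2 ^ t := by
  induction t with
  | zero => simp [potential_zero]
  | succ t ih =>
    obtain ⟨c, u, hc, hη, hc0, hu, hu1, hc2, -, -⟩ := exists_params hN (by omega) hγ
    rw [potential_succ, pow_succ, ← mul_assoc]
    refine mul_le_mul (ih (by omega)) ?_
      (growth_nonneg (fun i j => (pairWeight_pos hN _ _ i j).le) _ _ _ _ _)
      ((potential_nonneg _ _ _ _).trans (ih (by omega)))
    have hp := div_le_strategy (η := etaParam (N k) n) (g := g) (I := I) hN hγ t ω
    have hδ := sum_pairWeight hN (etaParam (N k) n)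
      (estimatedRegret (etaParam (N k) n) (gammaParam (N k) n) k g I t ω)
    have h0 := fun i j => (pairWeight_pos hN (etaParam (N k) n)
      (estimatedRegret (etaParam (N k) n) (gammaParam (N k) n) k g I t ω) i j).le
    have hs := sum_strategy (η := etaParam (N k) n) (γ := gammaParam (N k) n) (g := g) (I := I)
      hN t ω
    rw [hc] at hp
    have := growth_le hc0 hu hu1 hc2 hp hs (h.rewardOf_mem (t := t) (by omega) ω) h0 hδ i j
      (I t ω k)
    rwa [← hη] at this

lemma integrable_potential [IsProbabilityMeasure μ] (h : IsRun μ ℱ n k g I) (hN : 2 ≤ N k)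
    (hγ : gammaParam (N k) n ≤ 1) {t : ℕ} (ht : t ≤ n) (i j : Fin (N k)) :
    Integrable (potential (etaParam (N k) n) (gammaParam (N k) n) k g I i j t) μ := by
  refine Integrable.of_bound ((h.aestronglyMeasurable_potential ht i j).mono (ℱ.le t))
    ((N k : ℝ) * (N k - 1) * Real.exp 2 ^ t) (Eventually.of_forall fun ω => ?_)
  rw [Real.norm_of_nonneg (potential_nonneg _ _ _ _)]
  exact h.potential_le hN hγ ht i j ω

lemma integral_potential_succ_le [IsProbabilityMeasure μ] (h : IsRun μ ℱ n k g I) (hN : 2 ≤ N k)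
    (hγ : gammaParam (N k) n ≤ 1) {u : ℝ} (hu : 0 ≤ u) (hu1 : u ≤ 1)
    (hη : etaParam (N k) n = u * (gammaParam (N k) n / N k))
    (hc0 : 0 < gammaParam (N k) n / N k) (hc2 : gammaParam (N k) n / N k ≤ 1 / 2)
    (hcu : gammaParam (N k) n / N k ≤ u) {t : ℕ} (ht : t < n) (i j : Fin (N k)) :
    ∫ ω, potential (etaParam (N k) n) (gammaParam (N k) n) k g I i j (t + 1) ω ∂μ ≤
      Real.exp (17 * u ^ 3) *
        ∫ ω, potential (etaParam (N k) n) (gammaParam (N k) n) k g I i j t ω ∂μ := by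
  set M := potential (etaParam (N k) n) (gammaParam (N k) n) k g I i j with hM
  set p := strategy (etaParam (N k) n) (gammaParam (N k) n) k g I t with hp
  set G : Fin (N k) → Ω → ℝ := fun a ω => growth (etaParam (N k) n) (pairWeight (etaParam (N k) n)
    (estimatedRegret (etaParam (N k) n) (gammaParam (N k) n) k g I t ω)) (p ω)
    (rewardOf k g I t ω) i j a with hG
  have hpc : ∀ ω i, gammaParam (N k) n / N k ≤ p ω i := fun ω => div_le_strategy hN hγ t ω
  have hps : ∀ ω, ∑ i, p ω i = 1 := fun ω => sum_strategy hN t ω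
  have hδ := fun ω => sum_pairWeight hN (etaParam (N k) n)
    (estimatedRegret (etaParam (N k) n) (gammaParam (N k) n) k g I t ω)
  have h0 := fun ω i j => (pairWeight_pos hN (etaParam (N k) n)
    (estimatedRegret (etaParam (N k) n) (gammaParam (N k) n) k g I t ω) i j).le
  have hGle : ∀ a ω, G a ω ≤ Real.exp 2 := fun a ω => by
    have := growth_le hc0 hu hu1 hc2 (hpc ω) (hps ω) (h.rewardOf_mem ht ω) (h0 ω) (hδ ω) i j a
    rwa [← hη] at this
  have hG0 : ∀ a ω, 0 ≤ G a ω := fun a ω => growth_nonneg (h0 ω) _ _ _ _ _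
  have hGm : ∀ a, AEStronglyMeasurable[ℱ t] (G a) μ := h.aestronglyMeasurable_growth ht i j
  have hMm : AEStronglyMeasurable[ℱ t] (M t) μ := h.aestronglyMeasurable_potential ht.le i j
  have hMi : Integrable (M t) μ := h.integrable_potential hN hγ ht.le i j
  have hi : ∀ a, Integrable (fun ω => M t ω * G a ω) μ := fun a =>
    hMi.mul_bdd ((hGm a).mono (ℱ.le t)) (c := Real.exp 2) (Eventually.of_forall fun ω => by
      rw [Real.norm_of_nonneg (hG0 a ω)]; exact hGle a ω)
  have hind : ∀ a, Integrable (fun ω => M t ω * G a ω *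
      Set.indicator {ω | I t ω k = a} (fun _ => (1 : ℝ)) ω) μ := fun a => by
    refine ((hi a).indicator (ℱ.le _ _ (h.action_meas t ht a))).congr
      (Eventually.of_forall fun ω => ?_)
    by_cases hω : I t ω k = a <;> simp [hω, Set.indicator]
  have hpi : ∀ a, Integrable (fun ω => M t ω * G a ω * p ω a) μ := fun a =>
    (hi a).mul_bdd ((h.aestronglyMeasurable_strategy ht a).mono (ℱ.le t)) (c := 1)
      (Eventually.of_forall fun ω => by
        rw [Real.norm_of_nonneg (hc0.le.trans (hpc ω a))]
        exact le_one_of_sum_eq_one hc0 (hpc ω) (hps ω) a)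
  calc ∫ ω, M (t + 1) ω ∂μ
      = ∫ ω, ∑ a, M t ω * G a ω * Set.indicator {ω | I t ω k = a} (fun _ => (1 : ℝ)) ω ∂μ := by
        -- The random action is split into its possible values; for each fixed `a` the growth factor
        -- is known before the draw, so the indicator can be replaced by its conditional
        -- probability.
        refine integral_congr_ae (Eventually.of_forall fun ω => ?_)
        simp only [hM, potential_succ, Set.indicator, Set.mem_ofPred_eq, mul_ite, mul_one, mul_zero,
          Finset.sum_ite_eq, Finset.mem_univ, if_true]
        rfl
    _ = ∑ a, ∫ ω, M t ω * G a ω * p ω a ∂μ := by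
        rw [integral_finsetSum _ fun a _ => hind a]
        exact Finset.sum_congr rfl fun a _ =>
          h.integral_indicator_action_mul ht a (hMm.mul (hGm a)) (hi a)
    _ = ∫ ω, ∑ a, M t ω * G a ω * p ω a ∂μ := (integral_finsetSum _ fun a _ => hpi a).symm
    _ ≤ ∫ ω, Real.exp (17 * u ^ 3) * M t ω ∂μ := by
        refine integral_mono (integrable_finsetSum _ fun a _ => hpi a) (hMi.const_mul _) fun ω => ?_
        obtain ⟨q, hq, hpq⟩ := exists_fixedPoint_strategy (η := etaParam (N k) n)
          (γ := gammaParam (N k) n) (g := g) (I := I) hN t ω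
        have h1 := sum_mul_growth_le hc0 hu hu1 hc2 (hpc ω) (hps ω) (h.rewardOf_mem ht ω) (h0 ω)
          (hδ ω) hcu hq hpq i j
        rw [← hη] at h1
        have h2 := mul_le_mul_of_nonneg_left h1
          (potential_nonneg (η := etaParam (N k) n) (γ := gammaParam (N k) n) (g := g) (I := I)
            i j t ω)
        rw [Finset.mul_sum] at h2
        refine le_trans (le_of_eq (Finset.sum_congr rfl fun a _ => ?_)) (h2.trans_eq (mul_comm _ _))
        simp only [hM, hG]; ring
    _ = _ := integral_const_mul _ _

lemma integral_potential_le [IsProbabilityMeasure μ] (h : IsRun μ ℱ n k g I) (hN : 2 ≤ N k)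
    (hn : 0 < n) (hγ : gammaParam (N k) n ≤ 1) (i j : Fin (N k)) :
    ∫ ω, potential (etaParam (N k) n) (gammaParam (N k) n) k g I i j n ω ∂μ ≤
      (N k : ℝ) ^ 11 := by
  obtain ⟨c, u, rfl, hη, hc0, hu, hu1, hc2, hcu, hnu⟩ := exists_params hN hn hγ
  have hN' : (2 : ℝ) ≤ N k := by exact_mod_cast hN
  have key : ∀ t ≤ n, ∫ ω, potential (etaParam (N k) n) (gammaParam (N k) n) k g I i j t ω ∂μ ≤
      Real.exp (17 * u ^ 3) ^ t * ((N k : ℝ) * (N k - 1)) := by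
    intro t ht
    induction t with
    | zero => simp [potential_zero]
    | succ t ih =>
      refine (h.integral_potential_succ_le hN hγ hu hu1 hη hc0 hc2 hcu (by omega) i j).trans ?_
      rw [pow_succ' (Real.exp _), mul_assoc]
      exact mul_le_mul_of_nonneg_left (ih (by omega)) (Real.exp_pos _).le
  refine (key n le_rfl).trans ?_
  -- The exponent is `17 * n * u ^ 3 ≤ 17 / 2 * log N`, rounded up to `9 * log N`.
  have h1 : Real.exp (17 * u ^ 3) ^ n ≤ (N k : ℝ) ^ 9 := by
    rw [← Real.exp_nat_mul, ← Real.le_log_iff_exp_le (by positivity), Real.log_pow]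
    have := log_natCast_ge_half hN
    push_cast
    linarith
  calc _ ≤ (N k : ℝ) ^ 9 * ((N k : ℝ) * N k) := by
        refine mul_le_mul h1 (by gcongr; linarith) ?_ (by positivity)
        exact mul_nonneg (by positivity) (by linarith)
    _ = _ := by ring

/-- The exponential moment from which the bounds on the internal regret follow. -/
lemma integral_exp_internalRegret_le [IsProbabilityMeasure μ] (h : IsRun μ ℱ n k g I)
    (hN : 2 ≤ N k) (hn : 0 < n) (hγ : gammaParam (N k) n ≤ 1) :
    Integrable (fun ω => Real.exp (etaParam (N k) n * internalRegret n k g I ω)) μ ∧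
      ∫ ω, Real.exp (etaParam (N k) n * internalRegret n k g I ω) ∂μ ≤ (N k : ℝ) ^ 13 := by
  have hN' : (2 : ℝ) ≤ N k := by exact_mod_cast hN
  have hη := etaParam_pos hN hn
  have h1 : Integrable (fun ω => Real.exp (etaParam (N k) n * internalRegret n k g I ω)) μ := by
    refine Integrable.of_bound (Real.continuous_exp.comp_aestronglyMeasurable
      (h.aestronglyMeasurable_internalRegret.const_mul _)) (Real.exp (etaParam (N k) n * n)) ?_
    filter_upwards [h.ae_internalRegret_le] with ω hω
    rw [Real.norm_of_nonneg (Real.exp_pos _).le]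
    gcongr
  refine ⟨h1, ?_⟩
  have hi := fun e : Fin (N k) × Fin (N k) => h.integrable_potential hN hγ le_rfl e.1 e.2
  calc _ ≤ ∫ ω, (1 + ∑ e ∈ (Finset.univ : Finset (Fin (N k))).offDiag,
        potential (etaParam (N k) n) (gammaParam (N k) n) k g I e.1 e.2 n ω) ∂μ :=
        integral_mono h1 ((integrable_const _).add (integrable_finsetSum _ fun e _ => hi e))
          fun ω => exp_internalRegret_le hN n ω
    _ = 1 + ∑ e ∈ (Finset.univ : Finset (Fin (N k))).offDiag,
        ∫ ω, potential (etaParam (N k) n) (gammaParam (N k) n) k g I e.1 e.2 n ω ∂μ := by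
        rw [integral_add (integrable_const _) (integrable_finsetSum _ fun e _ => hi e),
          integral_finsetSum _ fun e _ => hi e]
        simp
    _ ≤ 1 + ((N k : ℝ) * N k - N k) * (N k : ℝ) ^ 11 := by
        refine add_le_add le_rfl ((Finset.sum_le_card_nsmul _ _ _ fun e _ =>
          h.integral_potential_le hN hn hγ e.1 e.2).trans_eq ?_)
        rw [Finset.offDiag_card, Finset.card_univ, Fintype.card_fin, nsmul_eq_mul,
          Nat.cast_sub (Nat.le_mul_self _)]
        push_cast; ring
    _ ≤ _ := by
        -- The diagonal pairs, left out of the sum, leave room `N ^ 12` for the extra summand `1`.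
        have : 1 ≤ (N k : ℝ) ^ 12 := one_le_pow₀ (by linarith)
        have e : ((N k : ℝ) * N k - N k) * (N k : ℝ) ^ 11 = (N k : ℝ) ^ 13 - (N k : ℝ) ^ 12 := by
          ring
        linarith

/-! ### From the exponential moment to bounds on the regret -/

lemma integral_internalRegret_le [IsProbabilityMeasure μ] (h : IsRun μ ℱ n k g I) :
    ∫ ω, internalRegret n k g I ω ∂μ ≤ 26 * rate (N k) n := by
  have hr := rate_nonneg (N k) n
  rcases le_or_gt (N k) 1 with hN | hN
  · simp only [internalRegret_eq_zero hN, integral_zero]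
    positivity
  have hN : 2 ≤ N k := hN
  have htriv : ∫ ω, internalRegret n k g I ω ∂μ ≤ n := by
    refine (integral_mono_ae h.integrable_internalRegret (integrable_const _)
      h.ae_internalRegret_le).trans_eq ?_
    simp
  rcases Nat.eq_zero_or_pos n with rfl | hn
  · push_cast at htriv
    linarith
  rcases le_or_gt (gammaParam (N k) n) 1 with hγ | hγ
  swap
  · linarith [natCast_le_rate hN hn hγ]
  have hη := etaParam_pos hN hn
  have hN' : (0 : ℝ) < N k := by positivity
  obtain ⟨hi, hle⟩ := h.integral_exp_internalRegret_le hN hn hγ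
  -- This is Jensen's inequality in tangent form: `1 + y ≤ exp y` at `y = η * R - 13 * log N`, where
  -- the shift matches the moment bound `N ^ 13`.
  have hpt : ∀ ω, etaParam (N k) n * internalRegret n k g I ω ≤
      Real.exp (etaParam (N k) n * internalRegret n k g I ω) / (N k : ℝ) ^ 13 +
        (13 * Real.log (N k) - 1) := by
    intro ω
    have h1 := Real.add_one_le_exp
      (etaParam (N k) n * internalRegret n k g I ω - 13 * Real.log (N k))
    have h2 : Real.exp (13 * Real.log (N k)) = (N k : ℝ) ^ 13 := by
      rw [← Real.exp_log (pow_pos hN' 13), Real.log_pow]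
      norm_num
    rw [Real.exp_sub, h2] at h1
    linarith
  have h3 : etaParam (N k) n * ∫ ω, internalRegret n k g I ω ∂μ ≤ 13 * Real.log (N k) := by
    rw [← integral_const_mul]
    refine (integral_mono (h.integrable_internalRegret.const_mul _)
      ((hi.div_const _).add (integrable_const _)) hpt).trans ?_
    simp only [Pi.add_apply]
    rw [integral_add (hi.div_const _) (integrable_const _), integral_div]
    have : (∫ ω, Real.exp (etaParam (N k) n * internalRegret n k g I ω) ∂μ) / (N k : ℝ) ^ 13 ≤ 1 :=
      (div_le_one (by positivity)).2 hle
    simp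
    linarith
  have h4 : ∫ ω, internalRegret n k g I ω ∂μ ≤ 13 * (Real.log (N k) / etaParam (N k) n) := by
    rw [← mul_div_assoc, le_div_iff₀ hη]
    linarith
  linarith [log_div_etaParam_le hN hn]

lemma measureReal_lt_internalRegret_le [IsProbabilityMeasure μ] (h : IsRun μ ℱ n k g I) {C : ℝ}
    (hC : 0 < C) : μ.real {ω | C * rate (N k) n < internalRegret n k g I ω} ≤ 26 / C := by
  rcases (rate_nonneg (N k) n).eq_or_lt with hr | hr
  -- If the rate is zero, Markov's inequality at level `0` says nothing; but then the nonnegative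
  -- regret has mean zero and vanishes almost surely.
  · have h1 := h.integral_internalRegret_le
    rw [← hr, mul_zero] at h1
    have h2 := (integral_eq_zero_iff_of_nonneg (fun ω => internalRegret_nonneg n ω)
      h.integrable_internalRegret).1
      (h1.antisymm (integral_nonneg fun ω => internalRegret_nonneg n ω))
    have h3 : μ {ω | C * rate (N k) n < internalRegret n k g I ω} = 0 := by
      refine measure_eq_zero_iff_ae_notMem.2 ?_
      filter_upwards [h2] with ω hω
      simp [hω, ← hr]
    rw [measureReal_def, h3]
    simp only [ENNReal.toReal_zero]
    positivity
  · have h1 := mul_meas_ge_le_integral_of_nonneg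
      (Eventually.of_forall fun ω => internalRegret_nonneg n ω) h.integrable_internalRegret
      (C * rate (N k) n)
    have h2 : μ.real {ω | C * rate (N k) n < internalRegret n k g I ω} ≤
        μ.real {ω | C * rate (N k) n ≤ internalRegret n k g I ω} :=
      by
      refine measureReal_mono fun ω hω => ?_
      simp only [Set.mem_ofPred_eq] at hω ⊢
      exact hω.le
    have h3 := h1.trans h.integral_internalRegret_le
    have h4 : C * μ.real {ω | C * rate (N k) n ≤ internalRegret n k g I ω} ≤ 26 :=
      le_of_mul_le_mul_right (by linarith) hr
    rw [le_div_iff₀ hC]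
    nlinarith

lemma measureReal_le_internalRegret_le [IsProbabilityMeasure μ] (h : IsRun μ ℱ n k g I)
    (hN : 2 ≤ N k) (hn : 0 < n) (hγ : gammaParam (N k) n ≤ 1) {ε : ℝ} (hε : 0 < ε) :
    μ.real {ω | ε * n ≤ internalRegret n k g I ω} ≤
      720 * (N k : ℝ) ^ 13 / (ε ^ 6 * (Real.log (N k) / (2 * N k)) ^ 4) * (1 / (n : ℝ) ^ 2) := by
  have hη := etaParam_pos hN hn
  have hN' : (0 : ℝ) < N k := by positivity
  have hn' : (0 : ℝ) < n := by positivity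
  have hL : 0 < Real.log (N k) := by linarith [log_natCast_ge_half hN]
  obtain ⟨hi, hle⟩ := h.integral_exp_internalRegret_le hN hn hγ
  have h1 := (mul_meas_ge_le_integral_of_nonneg
      (Eventually.of_forall fun ω => (Real.exp_pos _).le) hi
      (Real.exp (etaParam (N k) n * (ε * n)))).trans hle
  have h2 : μ.real {ω | ε * n ≤ internalRegret n k g I ω} ≤
      μ.real {ω | Real.exp (etaParam (N k) n * (ε * n)) ≤
        Real.exp (etaParam (N k) n * internalRegret n k g I ω)} :=
    measureReal_mono fun ω hω => Real.exp_le_exp.2 (mul_le_mul_of_nonneg_left hω hη.le)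
  -- Since `η ^ 3` is a multiple of `n ^ (-2)`, the sixth power of `η * ε * n` grows like `n ^ 2`;
  -- the corresponding term of the exponential series gives a summable tail.
  have h3 : ε ^ 6 * (Real.log (N k) / (2 * N k)) ^ 4 * (n : ℝ) ^ 2 / 720 ≤
      Real.exp (etaParam (N k) n * (ε * n)) := by
    have h4 := Real.pow_div_factorial_le_exp (etaParam (N k) n * (ε * n)) (by positivity) 6
    have e : (etaParam (N k) n * (ε * n)) ^ 6 = (etaParam (N k) n ^ 3) ^ 2 * ε ^ 6 * n ^ 6 := by ring
    rw [e, etaParam_cube] at h4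
    refine le_trans (le_of_eq ?_) h4
    norm_num [Nat.factorial]
    field_simp
  have hpos : 0 < ε ^ 6 * (Real.log (N k) / (2 * N k)) ^ 4 * (n : ℝ) ^ 2 / 720 := by positivity
  have h5 : ε ^ 6 * (Real.log (N k) / (2 * N k)) ^ 4 * (n : ℝ) ^ 2 / 720 *
      μ.real {ω | ε * n ≤ internalRegret n k g I ω} ≤ (N k : ℝ) ^ 13 :=
    (mul_le_mul h3 h2 measureReal_nonneg (Real.exp_pos _).le).trans h1
  have h6 := (le_div_iff₀' hpos).2 h5
  refine h6.trans_eq ?_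
  field_simp

end IsRun

/-! ### Almost sure convergence -/

lemma ae_tendsto_internalRegret_div [IsProbabilityMeasure μ] {ℱ : ℕ → Filtration ℕ m}
    {g : ℕ → ℕ → Ω → (∀ l, Fin (N l)) → ℝ} {I : ℕ → ℕ → Ω → ∀ l, Fin (N l)}
    (h : ∀ᶠ n in atTop, IsRun μ (ℱ n) n k (g n) (I n)) :
    ∀ᵐ ω ∂μ, Tendsto (fun n : ℕ => internalRegret n k (g n) (I n) ω / n) atTop (𝓝 0) := by
  rcases le_or_gt (N k) 1 with hN | hN
  · refine Eventually.of_forall fun ω => ?_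
    simp [internalRegret_eq_zero hN]
  have hN : 2 ≤ N k := hN
  have key : ∀ j : ℕ, ∀ᵐ ω ∂μ, ∀ᶠ n : ℕ in atTop,
      internalRegret n k (g n) (I n) ω < 1 / ((j : ℝ) + 1) * n := by
    intro j
    obtain ⟨n₀, h₀⟩ := eventually_atTop.1
      ((h.and (eventually_gammaParam_le_one (N k))).and (eventually_gt_atTop 0))
    -- The clause `n₀ ≤ n` empties the events for small horizons, where no run is assumed.
    -- Borel–Cantelli needs only summability, so the dependence between horizons is irrelevant.
    have hsum : Summable fun n : ℕ => μ.real
        {ω | n₀ ≤ n ∧ 1 / ((j : ℝ) + 1) * n ≤ internalRegret n k (g n) (I n) ω} := by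
      refine Summable.of_nonneg_of_le (fun _ => measureReal_nonneg) (fun n => ?_)
        ((Real.summable_one_div_nat_pow.2 one_lt_two).mul_left
          (720 * (N k : ℝ) ^ 13 / ((1 / ((j : ℝ) + 1)) ^ 6 * (Real.log (N k) / (2 * N k)) ^ 4)))
      by_cases hn : n₀ ≤ n
      · obtain ⟨⟨h1, h2⟩, h3⟩ := h₀ n hn
        simp only [hn, true_and]
        exact h1.measureReal_le_internalRegret_le hN h3 h2 (by positivity)
      · have hL : 0 < Real.log (N k) := by linarith [log_natCast_ge_half hN]
        simp only [hn, false_and, Set.ofPred_false, measureReal_empty]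
        positivity
    have hfin : ∑' n : ℕ, μ {ω | n₀ ≤ n ∧
        1 / ((j : ℝ) + 1) * n ≤ internalRegret n k (g n) (I n) ω} ≠ ⊤ := by
      have := hsum.tsum_ofReal_ne_top
      simpa only [ofReal_measureReal (measure_ne_top _ _)] using this
    filter_upwards [ae_eventually_notMem hfin] with ω hω
    filter_upwards [hω, eventually_ge_atTop n₀] with n h1 h2
    by_contra! h3
    exact h1 ⟨h2, h3⟩
  filter_upwards [ae_all_iff.2 key] with ω hω
  -- The version with strict `n > n₀` is used so that `n` is positive and can be divided by.
  rw [Metric.tendsto_atTop']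
  intro ε hε
  obtain ⟨j, hj⟩ := exists_nat_one_div_lt hε
  obtain ⟨n₀, h₀⟩ := eventually_atTop.1 (hω j)
  refine ⟨n₀, fun n hn => ?_⟩
  have hn' : (0 : ℝ) < n := by exact_mod_cast (Nat.zero_le _).trans_lt hn
  rw [Real.dist_0_eq_abs, abs_of_nonneg (div_nonneg (internalRegret_nonneg _ _) hn'.le),
    div_lt_iff₀ hn']
  exact (h₀ n hn.le).trans (mul_lt_mul_of_pos_right hj hn')

end Probability

end NRBEWAS

end

theorem mainTheorem2 :
    -- the rate in expectation, with an absolute constant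
    (∃ C : ℝ, 0 < C ∧
      ∀ (K : ℕ) (N : Fin K → ℕ) (k : Fin K) (n : ℕ)
        (Ω : Type*) (m : MeasurableSpace Ω) (μ : Measure Ω), IsProbabilityMeasure μ →
      ∀ (ℱ : Filtration ℕ m) (g : ℕ → Ω → (∀ l, Fin (N l)) → ℝ) (I : ℕ → Ω → ∀ l, Fin (N l)),
        NRBEWAS.IsRun μ ℱ n k g I →
        Integrable (NRBEWAS.internalRegret n k g I) μ ∧
          ∫ ω, NRBEWAS.internalRegret n k g I ω ∂μ ≤ C * NRBEWAS.rate (N k) n) ∧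
    -- the rate with arbitrarily high probability
    (∀ δ : ℝ, 0 < δ → ∃ C : ℝ, 0 < C ∧
      ∀ (K : ℕ) (N : Fin K → ℕ) (k : Fin K) (n : ℕ)
        (Ω : Type*) (m : MeasurableSpace Ω) (μ : Measure Ω), IsProbabilityMeasure μ →
      ∀ (ℱ : Filtration ℕ m) (g : ℕ → Ω → (∀ l, Fin (N l)) → ℝ) (I : ℕ → Ω → ∀ l, Fin (N l)),
        NRBEWAS.IsRun μ ℱ n k g I →
        μ {ω | C * NRBEWAS.rate (N k) n < NRBEWAS.internalRegret n k g I ω} ≤ ENNReal.ofReal δ) ∧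
    -- vanishing internal regret: runs with all large horizons `n`, coupled in any way
    (∀ (K : ℕ) (N : Fin K → ℕ) (k : Fin K)
        (Ω : Type*) (m : MeasurableSpace Ω) (μ : Measure Ω), IsProbabilityMeasure μ →
      ∀ (ℱ : ℕ → Filtration ℕ m) (g : ℕ → ℕ → Ω → (∀ l, Fin (N l)) → ℝ)
        (I : ℕ → ℕ → Ω → ∀ l, Fin (N l)),
        (∀ᶠ n in atTop, NRBEWAS.IsRun μ (ℱ n) n k (g n) (I n)) →
        ∀ᵐ ω ∂μ, Tendsto (fun n : ℕ => NRBEWAS.internalRegret n k (g n) (I n) ω / n)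
          atTop (𝓝 0)) := by
  refine ⟨⟨26, by norm_num, ?_⟩, fun δ hδ => ⟨26 / δ, by positivity, ?_⟩, ?_⟩
  · intro K N k n Ω m μ hμ ℱ g I h
    exact ⟨h.integrable_internalRegret, h.integral_internalRegret_le⟩
  · intro K N k n Ω m μ hμ ℱ g I h
    have h1 := h.measureReal_lt_internalRegret_le (C := 26 / δ) (by positivity)
    rw [div_div_cancel₀ (by norm_num)] at h1
    rw [← ofReal_measureReal (measure_ne_top _ _)]
    exact ENNReal.ofReal_le_ofReal h1
  · intro K N k Ω m μ hμ ℱ g I h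
    exact NRBEWAS.ae_tendsto_internalRegret_div h
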